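/- Let $\Gamma\in\mathbb{R}^{n\times n}$ be symmetric positive definite, $G\in\mathbb{R}^{m\times n}$ with $m\le n$, and $g\in\mathbb{R}^n$ with $g\neq 0$. Put $A=G\Gamma^{1/2}$ and $H=A^\top A$, and let $\lambda_1\ge\dots\ge\lambda_n\ge 0$ be the eigenvalues of $H$ (with $\lambda_{n+1}:=0$). The Gauss–Newton step $\delta x$ is the solution of $(\Gamma^{-1}+G^\top G)\,\delta x=-g$, where $\Gamma^{-1}+G^\top G=\Gamma^{-1/2}(I+H)\Gamma^{-1/2}$. Let $0\le r\le m$ and $p\ge 2$ be integers, $\ell=r+p$, and let $\Omega\in\mathbb{R}^{n\times\ell}$ be a standard Gaussian random matrix (independent $N(0,1)$ entries). The RandSVD sketch is obtained as follows: form $Y=A\Omega$; compute a thin QR factorization $Y=QR$, where $Q$ has $k=\min(m,\ell)$ orthonormal columns; form $W$ by $W^\top=A^\top Q$; compute a thin SVD $W=\widehat U\widehat\Sigma\widehat V^\top$; put $\widehat\Lambda=\widehat\Sigma^2$ and $\widehat H=\widehat V\widehat\Lambda\widehat V^\top$. Any valid choice of the two factorizations is allowed. The SketchSolv step is $$\delta\widehat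 x=-\Gamma^{1/2}(I+\widehat H)^{-1}\Gamma^{1/2}g .$$ Write $\|x\|_{\Gamma^{-1}}=\|\Gamma^{-1/2}x\|_2$, $\kappa_2(M)=\|M\|_2\|M^{-1}\|_2$, and $$\Psi_H(r,p)=\lambda_{r+1}+\frac{r}{p-1}\sum_{j>r}\lambda_j .$$ Then $\Psi_H(r,p)=\bigl(1+\frac{r}{p-1}\,\mathrm{id}_r\bigr)\lambda_{r+1}$ with $\mathrm{id}_r=\bigl(\sum_{j>r}\lambda_j\bigr)/\lambda_{r+1}$ whenever $\lambda_{r+1}\ne 0$, and the following expectations exist (the variables are integrable) and satisfy $$\mathbb{E}\left[\frac{\|\delta x-\delta\widehat x\|_{\Gamma^{-1}}}{\|\delta x\|_{\Gamma^{-1}}}\right]\le\Psi_H(r,p),$$ $$\mathbb{E}\left[\kappa_2\bigl((I+\widehat H)^{-1/2}(I+H)(I+\widehat H)^{-1/2}\bigr)\right]\le 1+\Psi_H(r,p).$$ -/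

import Mathlib

open MeasureTheory ProbabilityTheory
open scoped Matrix MatrixOrder

noncomputable section

namespace RandSketch

/-- The positive semidefinite square root `M^{1/2}` of a positive semidefinite real matrix. -/
def msqrt {n : ℕ} (M : Matrix (Fin n) (Fin n) ℝ) : Matrix (Fin n) (Fin n) ℝ := CFC.sqrt M

/-- The spectral norm `‖M‖₂`: the operator norm induced by the Euclidean norm. -/
def specNorm {n : ℕ} (M : Matrix (Fin n) (Fin n) ℝ) : ℝ :=
  ‖Matrix.toEuclideanCLM (n := Fin n) (𝕜 := ℝ) M‖

/-- The 2-norm condition number for inversion, `κ₂(M) = ‖M‖₂ ‖M⁻¹‖₂` (for invertible `M`). -/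
def condNum {n : ℕ} (M : Matrix (Fin n) (Fin n) ℝ) : ℝ := specNorm M * specNorm M⁻¹

/-- The weighted norm `‖x‖_M = ‖M^{1/2} x‖₂` for a symmetric positive definite `M`. -/
def weightedNorm {n : ℕ} (M : Matrix (Fin n) (Fin n) ℝ) (x : Fin n → ℝ) : ℝ :=
  ‖WithLp.toLp 2 (msqrt M *ᵥ x)‖

/-- The prior-preconditioned forward operator `A = G Γ^{1/2}`. -/
def precondOp {m n : ℕ} (Γ : Matrix (Fin n) (Fin n) ℝ) (G : Matrix (Fin m) (Fin n) ℝ) :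
    Matrix (Fin m) (Fin n) ℝ := G * msqrt Γ

/-- The data-misfit Hessian `H = Aᵀ A`. -/
def misfit {m n : ℕ} (A : Matrix (Fin m) (Fin n) ℝ) : Matrix (Fin n) (Fin n) ℝ := Aᵀ * A

theorem misfit_isHermitian {m n : ℕ} (A : Matrix (Fin m) (Fin n) ℝ) :
    (misfit A).IsHermitian := by
  simpa [misfit] using Matrix.isHermitian_conjTranspose_mul_self A

/-- The eigenvalues of `H = Aᵀ A` in decreasing order, with multiplicity, indexed from zero
and continued by zero: `eig A j` is `λ_{j+1}`. -/
def eig {m n : ℕ} (A : Matrix (Fin m) (Fin n) ℝ) (j : ℕ) : ℝ :=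
  if h : j < Fintype.card (Fin n) then (misfit_isHermitian A).eigenvalues₀ ⟨j, h⟩ else 0

/-- The tail sum `∑_{j > r} λ_j` (over one-based indices `r < j ≤ n`). -/
def eigTail {m n : ℕ} (A : Matrix (Fin m) (Fin n) ℝ) (r : ℕ) : ℝ :=
  ∑ j ∈ Finset.Ico r n, eig A j

/-- The intrinsic dimension `id_r = (∑_{j > r} λ_j) / λ_{r+1}` (for `λ_{r+1} ≠ 0`). -/
def intrinsicDim {m n : ℕ} (A : Matrix (Fin m) (Fin n) ℝ) (r : ℕ) : ℝ :=
  eigTail A r / eig A r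

/-- `Ψ_H(r,p) = λ_{r+1} + (r / (p - 1)) ∑_{j > r} λ_j`, for `H = Aᵀ A`. -/
def Psi {m n : ℕ} (A : Matrix (Fin m) (Fin n) ℝ) (r p : ℕ) : ℝ :=
  eig A r + (r : ℝ) / ((p : ℝ) - 1) * eigTail A r

/-- `Y = Q R` is a thin QR factorization of the `m × l` matrix `Y`: `Q` has `min m l` orthonormal
columns and `R` is upper triangular (trapezoidal if `m < l`). -/
structure IsThinQR {m l : ℕ} (Y : Matrix (Fin m) (Fin l) ℝ)
    (Q : Matrix (Fin m) (Fin (min m l)) ℝ) (R : Matrix (Fin (min m l)) (Fin l) ℝ) : Prop where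
  orthonormal : Qᵀ * Q = 1
  upper : ∀ (i : Fin (min m l)) (j : Fin l), (j : ℕ) < (i : ℕ) → R i j = 0
  factor : Y = Q * R

/-- `W = U diag(σ) Vᵀ` is a thin singular value decomposition of the `k × n` matrix `W`
(with `k ≤ n`). -/
structure IsThinSVD {k n : ℕ} (W : Matrix (Fin k) (Fin n) ℝ)
    (U : Matrix (Fin k) (Fin k) ℝ) (σ : Fin k → ℝ) (V : Matrix (Fin n) (Fin k) ℝ) : Prop where
  left_orthonormal : Uᵀ * U = 1
  right_orthonormal : Vᵀ * V = 1
  nonneg : ∀ i, 0 ≤ σ i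
  antitone : Antitone σ
  factor : W = U * Matrix.diagonal σ * Vᵀ

/-- `(V, Λ)`, with `Λ = diag(lam)`, is an output of the randomized SVD sketch for the operator `A`
and the test matrix `Ω`: `Y = A Ω`, `Y = Q R` is a thin QR factorization, `Wᵀ = Aᵀ Q`,
`W = U Σ Vᵀ` is a thin SVD, `Λ = Σ²`. The two factorizations are not unique, and any of them may
be chosen. -/
def IsRandSVDOutput {m n l : ℕ} (A : Matrix (Fin m) (Fin n) ℝ) (Ω : Matrix (Fin n) (Fin l) ℝ)
    (V : Matrix (Fin n) (Fin (min m l)) ℝ) (lam : Fin (min m l) → ℝ) : Prop :=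
  ∃ (Q : Matrix (Fin m) (Fin (min m l)) ℝ) (R : Matrix (Fin (min m l)) (Fin l) ℝ)
    (U : Matrix (Fin (min m l)) (Fin (min m l)) ℝ) (σ : Fin (min m l) → ℝ),
    IsThinQR (A * Ω) Q R ∧ IsThinSVD ((Aᵀ * Q)ᵀ) U σ V ∧ ∀ i, lam i = σ i ^ 2

/-- The sketched matrix `Ĥ = V Λ Vᵀ` with `Λ = diag(lam)`. -/
def sketch {n k : ℕ} (V : Matrix (Fin n) (Fin k) ℝ) (lam : Fin k → ℝ) :
    Matrix (Fin n) (Fin n) ℝ := V * Matrix.diagonal lam * Vᵀ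

/-- The Gauss-Newton Hessian `Γ⁻¹ + Gᵀ G = Γ^{-1/2} (I + H) Γ^{-1/2}`. -/
def gnHessian {m n : ℕ} (Γ : Matrix (Fin n) (Fin n) ℝ) (G : Matrix (Fin m) (Fin n) ℝ) :
    Matrix (Fin n) (Fin n) ℝ := Γ⁻¹ + Gᵀ * G

/-- The exact Gauss-Newton step `δx`, the solution of `(Γ⁻¹ + Gᵀ G) δx = -g`. -/
def gnStep {m n : ℕ} (Γ : Matrix (Fin n) (Fin n) ℝ) (G : Matrix (Fin m) (Fin n) ℝ)
    (g : Fin n → ℝ) : Fin n → ℝ := -((gnHessian Γ G)⁻¹ *ᵥ g)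

/-- The SketchSolv step `δx̂ = -Γ^{1/2} (I + Ĥ)⁻¹ Γ^{1/2} g`. -/
def sketchSolvStep {n : ℕ} (Γ Hhat : Matrix (Fin n) (Fin n) ℝ) (g : Fin n → ℝ) : Fin n → ℝ :=
  -((msqrt Γ * (1 + Hhat)⁻¹ * msqrt Γ) *ᵥ g)

/-- The Woodbury form of the SketchSolv step, valid when all the eigenvalues in `Λ` are positive;
`sketchSolvStep` is also meaningful when some of them vanish. -/
theorem sketchSolvStep_woodbury {n k : ℕ} (Γ : Matrix (Fin n) (Fin n) ℝ)
    (V : Matrix (Fin n) (Fin k) ℝ) (lam : Fin k → ℝ) (hV : Vᵀ * V = 1) (hlam : ∀ i, 0 < lam i)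
    (g : Fin n → ℝ) :
    sketchSolvStep Γ (sketch V lam) g =
      -((msqrt Γ * (1 - V * ((Matrix.diagonal lam)⁻¹ + 1)⁻¹ * Vᵀ) * msqrt Γ) *ᵥ g) := by
  have h1 : ((Matrix.diagonal lam)⁻¹ + 1 : Matrix (Fin k) (Fin k) ℝ)⁻¹ =
      Matrix.diagonal (fun i => lam i / (1 + lam i)) := by
    have h0 : (Matrix.diagonal lam)⁻¹ = Matrix.diagonal (fun i => (lam i)⁻¹) := by
      apply Matrix.inv_eq_right_inv
      rw [Matrix.diagonal_mul_diagonal, ← Matrix.diagonal_one]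
      congr 1
      funext i
      exact mul_inv_cancel₀ (hlam i).ne'
    rw [h0]
    apply Matrix.inv_eq_right_inv
    rw [← Matrix.diagonal_one, Matrix.diagonal_add, Matrix.diagonal_mul_diagonal]
    congr 1
    funext i
    have h2 := (hlam i).ne'
    have h3 : 1 + lam i ≠ 0 := by linarith [hlam i]
    field_simp
  have h4 : (1 + sketch V lam)⁻¹ =
      1 - V * ((Matrix.diagonal lam)⁻¹ + 1)⁻¹ * Vᵀ := by
    rw [h1]
    apply Matrix.inv_eq_right_inv
    set D := Matrix.diagonal lam
    set E := Matrix.diagonal (fun i => lam i / (1 + lam i))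
    have h5 : D - E - D * E = 0 := by
      simp only [D, E, Matrix.diagonal_mul_diagonal, Matrix.diagonal_sub]
      rw [← Matrix.diagonal_zero]
      congr 1
      funext i
      have h3 : 1 + lam i ≠ 0 := by linarith [hlam i]
      field_simp
      ring
    have h6 : V * D * Vᵀ * (V * E * Vᵀ) = V * (D * E) * Vᵀ := by
      calc V * D * Vᵀ * (V * E * Vᵀ) = V * D * (Vᵀ * V) * E * Vᵀ := by
            simp only [Matrix.mul_assoc]
        _ = V * (D * E) * Vᵀ := by rw [hV]; simp only [Matrix.mul_one, Matrix.mul_assoc]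
    have h7 : (1 + V * D * Vᵀ) * (1 - V * E * Vᵀ) = 1 + V * (D - E - D * E) * Vᵀ := by
      rw [Matrix.mul_sub, Matrix.mul_one, Matrix.add_mul, Matrix.one_mul, h6]
      simp only [Matrix.mul_sub, Matrix.sub_mul]
      abel
    simp only [sketch]
    rw [h7, h5]
    simp
  rw [sketchSolvStep, h4]

/-- The preconditioned operator `(I + Ĥ)^{-1/2} (I + H) (I + Ĥ)^{-1/2}`. -/
def precondHessian {n : ℕ} (H Hhat : Matrix (Fin n) (Fin n) ℝ) : Matrix (Fin n) (Fin n) ℝ :=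
  (msqrt (1 + Hhat))⁻¹ * (1 + H) * (msqrt (1 + Hhat))⁻¹

/-- `Ω` is a standard Gaussian random matrix: its entries are independent `N(0,1)` variables. -/
structure IsStdGaussianMatrix {S : Type*} [MeasurableSpace S] (P : Measure S) {n l : ℕ}
    (Ω : S → Matrix (Fin n) (Fin l) ℝ) : Prop where
  law : ∀ i j, HasLaw (fun s => Ω s i j) (gaussianReal 0 1) P
  indep : iIndepFun (fun (ij : Fin n × Fin l) s => Ω s ij.1 ij.2) P

end RandSketch

end

noncomputable section

namespace RandSketch

/-! ### Quadratic-form bounds and the deterministic perturbation estimates -/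

section Deterministic

variable {n : ℕ}

/-! Write `K` for the sketched matrix. If `0 ≤ K` and `0 ≤ H - K ≤ c`, then the relative step error
is at most `c` and the condition number at most `1 + c` (`norm_inv_sub_inv_mulVec_le`,
`condNum_precondHessian_le`). It remains to find such a random `c` with mean at most `Ψ`.

Since `K = Aᵀ Q Qᵀ A`, the form of `H - K` at `x` is the squared norm of `(I - Q Qᵀ) A x`. The
projector `I - Q Qᵀ` annihilates `A Ω`, so this is at most the `H`-form at `x - Ω z` for every `z`
(`IsRandSVDOutput.isSketchOf`). In eigenvector coordinates, with `N = B Ω`, choose `z` through a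
right inverse of the first `r` rows of `N` so that the leading coordinates of `x - Ω z` vanish. The
trailing ones give `c = λ_{r+1} + tailError` (`IsSketchOf.quadratic_le`), where `tailError` is a
weighted sum of squares `(wᵢ · N j)²` and `wᵢ` is a column of the right inverse.

Rotation invariance makes the rows of `N` independent standard Gaussian vectors, so a trailing row
is independent of `wᵢ` and the conditional mean of the square is `‖wᵢ‖²`. That is a diagonal entry
of the inverse Gram matrix, at most the inverse squared distance of one row to the span of the other
`r - 1`. The squared distance dominates a chi-square variable with `p + 1` degrees of freedom, whose
inverse has mean `1 / (p - 1)`. Summing over `r` columns and the trailing eigenvalues gives `Ψ`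
(`integral_tailError_le`).

Integrability also needs measurability, although the factorizations may be chosen in a nonmeasurable
way; `exists_measurable_sketch` shows that almost surely the choice does not affect `K`. -/

theorem norm_toLp_sq {k : ℕ} (v : Fin k → ℝ) : ‖WithLp.toLp 2 v‖ ^ 2 = v ⬝ᵥ v := by
  rw [EuclideanSpace.real_norm_sq_eq]
  simp [dotProduct, sq]

theorem dotProduct_le_norm_mul_norm {k : ℕ} (v w : Fin k → ℝ) :
    v ⬝ᵥ w ≤ ‖WithLp.toLp 2 v‖ * ‖WithLp.toLp 2 w‖ := by
  have := real_inner_le_norm (WithLp.toLp 2 v) (WithLp.toLp 2 w)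
  rw [EuclideanSpace.inner_toLp_toLp] at this
  simpa [dotProduct_comm] using this

theorem dotProduct_mulVec_comm_of_isSymm {M : Matrix (Fin n) (Fin n) ℝ} (hM : Mᵀ = M)
    (x y : Fin n → ℝ) : x ⬝ᵥ M *ᵥ y = y ⬝ᵥ M *ᵥ x := by
  rw [Matrix.dotProduct_mulVec, ← Matrix.mulVec_transpose, hM, dotProduct_comm]

/-- The Cauchy-Schwarz inequality for a positive semidefinite quadratic form. -/
theorem sq_dotProduct_mulVec_le {M : Matrix (Fin n) (Fin n) ℝ} (hM : Mᵀ = M)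
    (h0 : ∀ x, 0 ≤ x ⬝ᵥ M *ᵥ x) (x y : Fin n → ℝ) :
    (x ⬝ᵥ M *ᵥ y) ^ 2 ≤ (x ⬝ᵥ M *ᵥ x) * (y ⬝ᵥ M *ᵥ y) := by
  have := LinearMap.BilinForm.apply_mul_apply_le_of_forall_zero_le (Matrix.toBilin' M)
    (fun x => by rw [Matrix.toBilin'_apply']; exact h0 x) x y
  simp only [Matrix.toBilin'_apply'] at this
  rwa [dotProduct_mulVec_comm_of_isSymm hM y x, ← sq] at this

/-- A symmetric matrix with `0 ≤ M ≤ c` has norm at most `c`. -/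
theorem norm_mulVec_le_of_quadratic {M : Matrix (Fin n) (Fin n) ℝ} (hM : Mᵀ = M) {c : ℝ}
    (hc : 0 ≤ c) (h0 : ∀ x, 0 ≤ x ⬝ᵥ M *ᵥ x) (h1 : ∀ x, x ⬝ᵥ M *ᵥ x ≤ c * (x ⬝ᵥ x))
    (x : Fin n → ℝ) : ‖WithLp.toLp 2 (M *ᵥ x)‖ ≤ c * ‖WithLp.toLp 2 x‖ := by
  -- Cauchy-Schwarz for the form at the pair `M x`, `x` gives `‖M x‖⁴ ≤ c ‖M x‖² · c ‖x‖²`.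
  have h := sq_dotProduct_mulVec_le hM h0 (M *ᵥ x) x
  rw [dotProduct_mulVec_comm_of_isSymm hM (M *ᵥ x) x,
    dotProduct_mulVec_comm_of_isSymm hM x (M *ᵥ x)] at h
  have h2 : (M *ᵥ x ⬝ᵥ M *ᵥ x) * (M *ᵥ x ⬝ᵥ M *ᵥ x) ≤
      (M *ᵥ x ⬝ᵥ M *ᵥ x) * (c ^ 2 * (x ⬝ᵥ x)) := by
    rw [← sq]
    refine h.trans ((mul_le_mul (h1 (M *ᵥ x)) (h1 x) (h0 _) ?_).trans_eq (by ring))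
    exact mul_nonneg hc (by rw [← norm_toLp_sq]; positivity)
  refine abs_le_of_sq_le_sq' ?_ (by positivity) |>.2
  rw [mul_pow, norm_toLp_sq, norm_toLp_sq]
  have h3 : 0 ≤ M *ᵥ x ⬝ᵥ M *ᵥ x := by rw [← norm_toLp_sq]; positivity
  rcases h3.eq_or_lt with h4 | h4
  · rw [← h4, ← norm_toLp_sq]; positivity
  · exact le_of_mul_le_mul_left h2 h4

theorem specNorm_le_of_forall {M : Matrix (Fin n) (Fin n) ℝ} {c : ℝ} (hc : 0 ≤ c)
    (h : ∀ x : Fin n → ℝ, ‖WithLp.toLp 2 (M *ᵥ x)‖ ≤ c * ‖WithLp.toLp 2 x‖) :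
    specNorm M ≤ c := by
  refine ContinuousLinearMap.opNorm_le_bound _ hc fun x => ?_
  have := h x.ofLp
  rwa [← Matrix.toEuclideanCLM_toLp] at this

/-- Inverting a matrix that is bounded below by the identity. -/
theorem norm_le_norm_mulVec_of_quadratic {M : Matrix (Fin n) (Fin n) ℝ}
    (h : ∀ x, x ⬝ᵥ x ≤ x ⬝ᵥ M *ᵥ x) (x : Fin n → ℝ) :
    ‖WithLp.toLp 2 x‖ ≤ ‖WithLp.toLp 2 (M *ᵥ x)‖ := by
  have h1 := (h x).trans (dotProduct_le_norm_mul_norm x (M *ᵥ x))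
  rw [← norm_toLp_sq, sq] at h1
  rcases (norm_nonneg (WithLp.toLp 2 x)).eq_or_lt with h4 | h4
  · rw [← h4]; positivity
  · exact le_of_mul_le_mul_left h1 h4

theorem isUnit_of_quadratic {M : Matrix (Fin n) (Fin n) ℝ}
    (h : ∀ x, x ⬝ᵥ x ≤ x ⬝ᵥ M *ᵥ x) : IsUnit M.det := by
  rw [isUnit_iff_ne_zero]
  intro h0
  obtain ⟨v, hv, hv0⟩ := Matrix.exists_mulVec_eq_zero_iff.mpr h0
  have := norm_le_norm_mulVec_of_quadratic h v
  rw [hv0] at this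
  simp at this
  exact hv this

theorem quadratic_one_add_ge {K : Matrix (Fin n) (Fin n) ℝ} (h0 : ∀ x, 0 ≤ x ⬝ᵥ K *ᵥ x)
    (x : Fin n → ℝ) : x ⬝ᵥ x ≤ x ⬝ᵥ (1 + K) *ᵥ x := by
  rw [Matrix.add_mulVec, Matrix.one_mulVec, dotProduct_add]
  linarith [h0 x]

/-- Perturbation bound for the solution of `(I + H) u = w` when `0 ≤ K` and `0 ≤ H - K ≤ c`. -/
theorem norm_inv_sub_inv_mulVec_le {H K : Matrix (Fin n) (Fin n) ℝ} (hH : Hᵀ = H) (hK : Kᵀ = K)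
    (hK0 : ∀ x, 0 ≤ x ⬝ᵥ K *ᵥ x) {c : ℝ} (hc : 0 ≤ c) (h0 : ∀ x, 0 ≤ x ⬝ᵥ (H - K) *ᵥ x)
    (h1 : ∀ x, x ⬝ᵥ (H - K) *ᵥ x ≤ c * (x ⬝ᵥ x)) (w : Fin n → ℝ) :
    ‖WithLp.toLp 2 ((1 + H)⁻¹ *ᵥ w - (1 + K)⁻¹ *ᵥ w)‖ ≤ c * ‖WithLp.toLp 2 ((1 + H)⁻¹ *ᵥ w)‖ := by
  have hH0 : ∀ x, 0 ≤ x ⬝ᵥ H *ᵥ x := fun x => by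
    have := h0 x
    rw [Matrix.sub_mulVec, dotProduct_sub] at this
    linarith [hK0 x]
  have uH := isUnit_of_quadratic (quadratic_one_add_ge hH0)
  have uK := isUnit_of_quadratic (quadratic_one_add_ge hK0)
  set u := (1 + H)⁻¹ *ᵥ w
  have hu : (1 + H) *ᵥ u = w := by
    simp only [u]; rw [Matrix.mulVec_mulVec, Matrix.mul_nonsing_inv _ uH, Matrix.one_mulVec]
  set v := (1 + K)⁻¹ *ᵥ w
  have hv : (1 + K) *ᵥ v = w := by
    simp only [v]; rw [Matrix.mulVec_mulVec, Matrix.mul_nonsing_inv _ uK, Matrix.one_mulVec]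
  -- Both systems have right-hand side `w`; subtracting them leaves `H - K` acting on the exact
  -- solution `u`, hence a relative bound.
  have huv : (1 + K) *ᵥ (v - u) = (H - K) *ᵥ u := by
    rw [Matrix.mulVec_sub, hv, ← hu, ← Matrix.sub_mulVec]
    congr 1
    abel
  have h2 := norm_le_norm_mulVec_of_quadratic (quadratic_one_add_ge hK0) (v - u)
  rw [huv] at h2
  have h3 := norm_mulVec_le_of_quadratic (M := H - K)
    (by rw [Matrix.transpose_sub, hH, hK]) hc h0 h1 u
  rw [← norm_neg, ← WithLp.toLp_neg, neg_sub]
  exact h2.trans h3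

theorem nonneg_of_quadratic {M : Matrix (Fin n) (Fin n) ℝ} (hM : Mᵀ = M)
    (h0 : ∀ x, 0 ≤ x ⬝ᵥ M *ᵥ x) : 0 ≤ M := by
  rw [Matrix.nonneg_iff_posSemidef]
  refine Matrix.PosSemidef.of_dotProduct_mulVec_nonneg ?_ fun x => by simpa using h0 x
  rw [Matrix.IsHermitian, Matrix.conjTranspose_eq_transpose_of_trivial, hM]

theorem msqrt_transpose (M : Matrix (Fin n) (Fin n) ℝ) : (msqrt M)ᵀ = msqrt M := by
  have h : 0 ≤ msqrt M := CFC.sqrt_nonneg M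
  rw [Matrix.nonneg_iff_posSemidef] at h
  simpa [Matrix.IsHermitian] using h.1

theorem msqrt_mul_msqrt {M : Matrix (Fin n) (Fin n) ℝ} (hM : 0 ≤ M) :
    msqrt M * msqrt M = M := CFC.sqrt_mul_sqrt_self M hM

theorem isUnit_det_msqrt {M : Matrix (Fin n) (Fin n) ℝ} (hM : 0 ≤ M) (h : IsUnit M.det) :
    IsUnit (msqrt M).det := by
  rw [← msqrt_mul_msqrt hM, Matrix.det_mul] at h
  exact isUnit_of_mul_isUnit_left h

/-- The quadratic form of a congruence. -/
theorem dotProduct_congr_mulVec {S M : Matrix (Fin n) (Fin n) ℝ} (hS : Sᵀ = S) (x : Fin n → ℝ) :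
    x ⬝ᵥ (S * M * S) *ᵥ x = (S *ᵥ x) ⬝ᵥ M *ᵥ (S *ᵥ x) := by
  rw [← Matrix.mulVec_mulVec, ← Matrix.mulVec_mulVec, Matrix.dotProduct_mulVec,
    ← Matrix.mulVec_transpose, hS]

/-- Since `0 ≤ H - K ≤ c ≤ c (1 + K)`, congruence by the inverse root of `1 + K` places the
preconditioned matrix between `1` and `1 + c`. -/
theorem condNum_precondHessian_le {H K : Matrix (Fin n) (Fin n) ℝ} (hH : Hᵀ = H) (hK : Kᵀ = K)
    (hK0 : ∀ x, 0 ≤ x ⬝ᵥ K *ᵥ x) {c : ℝ} (hc : 0 ≤ c) (h0 : ∀ x, 0 ≤ x ⬝ᵥ (H - K) *ᵥ x)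
    (h1 : ∀ x, x ⬝ᵥ (H - K) *ᵥ x ≤ c * (x ⬝ᵥ x)) :
    condNum (precondHessian H K) ≤ 1 + c := by
  have uK := isUnit_of_quadratic (quadratic_one_add_ge hK0)
  have tK : (1 + K)ᵀ = 1 + K := by rw [Matrix.transpose_add, hK, Matrix.transpose_one]
  have pK : 0 ≤ 1 + K := nonneg_of_quadratic tK fun x =>
    le_trans (by rw [← norm_toLp_sq]; positivity) (quadratic_one_add_ge hK0 x)
  have uS := isUnit_det_msqrt pK uK
  have sS := msqrt_mul_msqrt pK
  have tS := msqrt_transpose (1 + K)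
  unfold precondHessian
  set S := msqrt (1 + K)
  have tS' : S⁻¹ᵀ = S⁻¹ := by rw [Matrix.transpose_nonsing_inv, tS]
  have q1 : ∀ x, (S⁻¹ *ᵥ x) ⬝ᵥ (1 + K) *ᵥ (S⁻¹ *ᵥ x) = x ⬝ᵥ x := fun x => by
    rw [← dotProduct_congr_mulVec tS', ← sS, ← Matrix.mul_assoc, Matrix.nonsing_inv_mul _ uS,
      Matrix.one_mul, Matrix.mul_nonsing_inv _ uS, Matrix.one_mulVec]
  have split : ∀ y : Fin n → ℝ, y ⬝ᵥ (1 + H) *ᵥ y = y ⬝ᵥ (1 + K) *ᵥ y + y ⬝ᵥ (H - K) *ᵥ y :=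
    fun y => by rw [← dotProduct_add, ← Matrix.add_mulVec]; congr 2; abel
  set M := S⁻¹ * (1 + H) * S⁻¹ with hM
  have tM : Mᵀ = M := by
    rw [hM, Matrix.transpose_mul, Matrix.transpose_mul, tS', Matrix.transpose_add, hH,
      Matrix.transpose_one, Matrix.mul_assoc]
  have lo : ∀ x, x ⬝ᵥ x ≤ x ⬝ᵥ M *ᵥ x := fun x => by
    rw [hM, dotProduct_congr_mulVec tS', split, q1]
    linarith [h0 (S⁻¹ *ᵥ x)]
  have hi : ∀ x, x ⬝ᵥ M *ᵥ x ≤ (1 + c) * (x ⬝ᵥ x) := fun x => by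
    rw [hM, dotProduct_congr_mulVec tS', split, q1]
    have := quadratic_one_add_ge hK0 (S⁻¹ *ᵥ x)
    rw [q1] at this
    have := mul_le_mul_of_nonneg_left this hc
    linarith [h1 (S⁻¹ *ᵥ x)]
  have n1 : specNorm M ≤ 1 + c := specNorm_le_of_forall (by linarith)
    (norm_mulVec_le_of_quadratic tM (by linarith)
      (fun x => le_trans (by rw [← norm_toLp_sq]; positivity) (lo x)) hi)
  have n2 : specNorm M⁻¹ ≤ 1 := specNorm_le_of_forall zero_le_one fun x => by
    have := norm_le_norm_mulVec_of_quadratic lo (M⁻¹ *ᵥ x)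
    rwa [Matrix.mulVec_mulVec, Matrix.mul_nonsing_inv _ (isUnit_of_quadratic lo),
      Matrix.one_mulVec, ← one_mul ‖WithLp.toLp 2 x‖] at this
  have : 0 ≤ specNorm M := norm_nonneg _
  calc condNum M = specNorm M * specNorm M⁻¹ := rfl
    _ ≤ (1 + c) * 1 := mul_le_mul n1 n2 (norm_nonneg _) (by linarith)
    _ = 1 + c := mul_one _

open scoped Matrix.Norms.L2Operator in
theorem specNorm_transpose_mul_self_comm (M : Matrix (Fin n) (Fin n) ℝ) :
    specNorm (Mᵀ * M) = specNorm (M * Mᵀ) := by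
  have h1 := Matrix.l2_opNorm_conjTranspose_mul_self M
  have h2 := Matrix.l2_opNorm_conjTranspose_mul_self Mᵀ
  have h3 := Matrix.l2_opNorm_conjTranspose M
  simp only [Matrix.conjTranspose_eq_transpose_of_trivial, Matrix.transpose_transpose] at h1 h2 h3
  change ‖Mᵀ * M‖ = ‖M * Mᵀ‖
  rw [h1, h2, h3]

/-- The condition number of the preconditioned operator, in a form without the root of the
sketched matrix. -/
theorem condNum_precondHessian_eq {H K : Matrix (Fin n) (Fin n) ℝ} (hH : Hᵀ = H) (hK : Kᵀ = K)
    (hH0 : ∀ x, 0 ≤ x ⬝ᵥ H *ᵥ x) (hK0 : ∀ x, 0 ≤ x ⬝ᵥ K *ᵥ x) :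
    condNum (precondHessian H K) =
      specNorm (msqrt (1 + H) * (1 + K)⁻¹ * msqrt (1 + H)) *
        specNorm ((msqrt (1 + H))⁻¹ * (1 + K) * (msqrt (1 + H))⁻¹) := by
  have key : ∀ {K : Matrix (Fin n) (Fin n) ℝ}, Kᵀ = K → (∀ x, 0 ≤ x ⬝ᵥ K *ᵥ x) →
      msqrt (1 + K) * msqrt (1 + K) = 1 + K ∧ IsUnit (msqrt (1 + K)).det := fun {K} hK hK0 => by
    have uK := isUnit_of_quadratic (quadratic_one_add_ge hK0)
    have tK : (1 + K)ᵀ = 1 + K := by rw [Matrix.transpose_add, hK, Matrix.transpose_one]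
    have pK : 0 ≤ 1 + K := nonneg_of_quadratic tK fun x =>
      le_trans (by rw [← norm_toLp_sq]; positivity) (quadratic_one_add_ge hK0 x)
    exact ⟨msqrt_mul_msqrt pK, isUnit_det_msqrt pK uK⟩
  obtain ⟨sS, uS⟩ := key hK hK0
  obtain ⟨sB, uB⟩ := key hH hH0
  have tS := msqrt_transpose (1 + K)
  have tB := msqrt_transpose (1 + H)
  unfold condNum precondHessian
  set S := msqrt (1 + K)
  set B := msqrt (1 + H)
  have tS' : S⁻¹ᵀ = S⁻¹ := by rw [Matrix.transpose_nonsing_inv, tS]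
  have tB' : B⁻¹ᵀ = B⁻¹ := by rw [Matrix.transpose_nonsing_inv, tB]
  have iS : (1 + K)⁻¹ = S⁻¹ * S⁻¹ := by rw [← sS, Matrix.mul_inv_rev]
  rw [Matrix.mul_inv_rev, Matrix.mul_inv_rev, Matrix.nonsing_inv_nonsing_inv _ uS, iS, ← sB,
    ← sS, Matrix.mul_inv_rev]
  -- Exchanging `MᵀM` and `MMᵀ` brings the two factors of the root `S` together, so that only `1 +
  -- K` and its inverse remain; the root `B` does not depend on `K`.
  have e1 := specNorm_transpose_mul_self_comm (B * S⁻¹)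
  have e2 := specNorm_transpose_mul_self_comm (B⁻¹ * S)
  rw [Matrix.transpose_mul, tB, tS'] at e1
  rw [Matrix.transpose_mul, tB', tS] at e2
  simp only [Matrix.mul_assoc] at e1 e2 ⊢
  rw [e1, e2]

end Deterministic

/-! ### Gaussian vectors and the inverse moment of chi-square -/

section Gaussian

open scoped ENNReal

variable {S : Type*} [MeasurableSpace S] {P : Measure S}

/-- Orthonormal combinations of independent standard normal variables are independent standard
normal variables. -/
theorem iIndepFun_orthonormal_sum {ι κ : Type*} [Fintype ι] [Fintype κ] [DecidableEq κ]
    {X : ι → S → ℝ} (hX : ∀ i, HasLaw (X i) (gaussianReal 0 1) P) (hi : iIndepFun X P)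
    (B : κ → ι → ℝ) (hB : ∀ k l, B k ⬝ᵥ B l = if k = l then 1 else 0) :
    (∀ k, HasLaw (fun s => ∑ i, B k i * X i s) (gaussianReal 0 1) P) ∧
      iIndepFun (fun k s => ∑ i, B k i * X i s) P := by
  classical
  have hP := hi.isProbabilityMeasure
  have hG : ∀ i, HasGaussianLaw (X i) P := fun i => (hX i).hasGaussianLaw
  have hL : ∀ i, MemLp (X i) 2 P := fun i => (hG i).memLp_two
  -- The combinations are jointly Gaussian as a linear image, so vanishing covariances will suffice
  -- for independence.
  have hJ : HasGaussianLaw (fun s k => ∑ i, B k i * X i s) P := by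
    let L : (ι → ℝ) →L[ℝ] (κ → ℝ) :=
      ContinuousLinearMap.pi fun k => ∑ i, B k i • ContinuousLinearMap.proj i
    have := (iIndepFun.hasGaussianLaw hG hi).map_fun L
    convert! this using 3 with s k
    simp [L]
  have hcov0 : ∀ i j, cov[X i, X j; P] = if i = j then 1 else 0 := fun i j => by
    split_ifs with h
    · subst h
      rw [covariance_self (hX i).aemeasurable, (hX i).variance_eq]
      simp
    · exact (hi.indepFun h).covariance_eq_zero (hL i) (hL j)
  have hcov : ∀ k l, cov[fun s => ∑ i, B k i * X i s, fun s => ∑ i, B l i * X i s; P] =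
      if k = l then 1 else 0 := fun k l => by
    rw [covariance_fun_sum_fun_sum (fun i => (hL i).const_mul _) (fun i => (hL i).const_mul _),
      ← hB k l]
    simp only [covariance_const_mul_left, covariance_const_mul_right, hcov0]
    simp [dotProduct, mul_comm]
  refine ⟨fun k => ⟨(hJ.eval k).aemeasurable, ?_⟩,
    hJ.iIndepFun_of_covariance_eq_zero fun k l h => by rw [hcov, if_neg h]⟩
  rw [(hJ.eval k).map_eq_gaussianReal]
  have hm : ∫ s, ∑ i, B k i * X i s ∂P = 0 := by
    rw [integral_finsetSum _ fun i _ => ((hG i).integrable.const_mul _)]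
    refine Finset.sum_eq_zero fun i _ => ?_
    rw [integral_const_mul, (hX i).integral_eq, integral_id_gaussianReal, mul_zero]
  have hv : Var[fun s => ∑ i, B k i * X i s; P] = 1 := by
    rw [← covariance_self (hJ.eval k).aemeasurable, hcov, if_pos rfl]
  rw [hm, hv, Real.toNNReal_one]

theorem mgf_sq_gaussianReal {X : S → ℝ} (hX : HasLaw X (gaussianReal 0 1) P) {t : ℝ}
    (ht : 0 ≤ t) : mgf (fun s => X s ^ 2) P (-t) = (1 + 2 * t) ^ (-(1 / 2) : ℝ) := by
  have h1 : mgf (fun s => X s ^ 2) P (-t) = ∫ x, Real.exp (-t * x ^ 2) ∂(gaussianReal 0 1) :=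
    hX.integral_comp (f := fun x => Real.exp (-t * x ^ 2)) (by fun_prop)
  rw [h1, integral_gaussianReal_eq_integral_smul (by simp)]
  have h2 : ∀ x : ℝ, gaussianPDFReal 0 1 x • Real.exp (-t * x ^ 2) =
      (√(2 * Real.pi))⁻¹ * Real.exp (-(t + 1 / 2) * x ^ 2) := fun x => by
    rw [gaussianPDFReal_def, smul_eq_mul, mul_assoc, ← Real.exp_add]
    simp only [NNReal.coe_one, mul_one, sub_zero]
    congr 2
    ring
  simp_rw [h2]
  rw [integral_const_mul, integral_gaussian, ← Real.sqrt_inv, ← Real.sqrt_mul (by positivity),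
    Real.rpow_neg (by positivity), ← Real.sqrt_eq_rpow, ← Real.sqrt_inv]
  congr 1
  field_simp
  ring

/-- Represents `1 / a` as a Laplace integral. For `a = 0` both sides are infinite, so no null set
has to be excluded later. -/
theorem lintegral_exp_neg_mul (a : ℝ) (ha : 0 ≤ a) :
    ∫⁻ t in Set.Ioi (0 : ℝ), ENNReal.ofReal (Real.exp (-t * a)) = (ENNReal.ofReal a)⁻¹ := by
  rcases ha.eq_or_lt with rfl | ha
  · simp
  · have hd : ∀ t ∈ Set.Ici (0 : ℝ),
        HasDerivAt (fun t => -a⁻¹ * Real.exp (-t * a)) (Real.exp (-t * a)) t := fun t _ => by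
      have := ((((hasDerivAt_id t).neg).mul_const a).exp).const_mul (-a⁻¹)
      convert! this using 1
      simp only [id, Pi.neg_apply]
      field_simp
    have hlim : Filter.Tendsto (fun t : ℝ => -a⁻¹ * Real.exp (-t * a)) Filter.atTop
        (nhds (-a⁻¹ * 0)) := by
      refine Filter.Tendsto.const_mul _ (Real.tendsto_exp_atBot.comp ?_)
      exact (Filter.tendsto_neg_atTop_atBot).atBot_mul_const ha
    have hi := integrableOn_Ioi_deriv_of_nonneg' hd (fun t _ => (Real.exp_pos _).le) hlim
    rw [← ofReal_integral_eq_lintegral_ofReal hi (ae_of_all _ fun t => (Real.exp_pos _).le),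
      integral_Ioi_of_hasDerivAt_of_nonneg' hd (fun t _ => (Real.exp_pos _).le) hlim,
      ← ENNReal.ofReal_inv_of_pos ha]
    simp

theorem lintegral_one_add_two_mul_rpow {b : ℝ} (hb : 1 < b) :
    ∫⁻ t in Set.Ioi (0 : ℝ), ENNReal.ofReal ((1 + 2 * t) ^ (-b)) =
      ENNReal.ofReal (1 / (2 * (b - 1))) := by
  have hd : ∀ t ∈ Set.Ici (0 : ℝ), HasDerivAt
      (fun t : ℝ => -(1 / (2 * (b - 1))) * (1 + 2 * t) ^ (-(b - 1))) ((1 + 2 * t) ^ (-b)) t :=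
    fun t ht => by
      have h0 : (1 + 2 * t) ≠ 0 := by have := Set.mem_Ici.mp ht; positivity
      have := ((((hasDerivAt_id t).const_mul 2).const_add 1).rpow_const
        (p := -(b - 1)) (Or.inl h0)).const_mul (-(1 / (2 * (b - 1))))
      convert! this using 1
      have : b - 1 ≠ 0 := by linarith
      rw [show -(b - 1) - 1 = -b by ring]
      simp only [id]
      field_simp
  have hn : ∀ t ∈ Set.Ioi (0 : ℝ), 0 ≤ (1 + 2 * t) ^ (-b) := fun t ht => by
    have := Set.mem_Ioi.mp ht
    positivity
  have hlim : Filter.Tendsto (fun t : ℝ => -(1 / (2 * (b - 1))) * (1 + 2 * t) ^ (-(b - 1)))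
      Filter.atTop (nhds (-(1 / (2 * (b - 1))) * 0)) := by
    refine Filter.Tendsto.const_mul _ ((tendsto_rpow_neg_atTop (by linarith)).comp ?_)
    exact Filter.tendsto_atTop_add_const_left _ _
      (Filter.tendsto_id.const_mul_atTop (by norm_num))
  have hi := integrableOn_Ioi_deriv_of_nonneg' hd hn hlim
  rw [← ofReal_integral_eq_lintegral_ofReal hi
      ((ae_restrict_iff' measurableSet_Ioi).mpr (ae_of_all _ hn)),
    integral_Ioi_of_hasDerivAt_of_nonneg' hd hn hlim]
  simp

/-- The mean of an inverse chi-square variable with `d ≥ 3` degrees of freedom. -/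
theorem lintegral_inv_sum_sq {d : ℕ} (hd : 3 ≤ d) {Z : Fin d → S → ℝ}
    (hZ : ∀ i, HasLaw (Z i) (gaussianReal 0 1) P) (hi : iIndepFun Z P) :
    ∫⁻ s, (ENNReal.ofReal (∑ i, Z i s ^ 2))⁻¹ ∂P = ENNReal.ofReal (1 / ((d : ℝ) - 2)) := by
  have hP := hi.isProbabilityMeasure
  have hm : ∀ i, AEMeasurable (Z i) P := fun i => (hZ i).aemeasurable
  have hsum : AEMeasurable (fun s => ∑ i, Z i s ^ 2) P :=
    Finset.aemeasurable_fun_sum _ fun i _ => (hm i).pow_const 2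
  -- After Tonelli, independence turns the inner expectation into `(1 + 2t)^(-d/2)`, which is
  -- integrable on the half-line because `d > 2`.
  have h1 : ∀ s, (ENNReal.ofReal (∑ i, Z i s ^ 2))⁻¹ =
      ∫⁻ t in Set.Ioi (0 : ℝ), ENNReal.ofReal (Real.exp (-t * ∑ i, Z i s ^ 2)) := fun s =>
    (lintegral_exp_neg_mul _ (Finset.sum_nonneg fun i _ => sq_nonneg _)).symm
  simp_rw [h1]
  rw [lintegral_lintegral_swap]
  · have h2 : ∀ t ∈ Set.Ioi (0 : ℝ),
        ∫⁻ s, ENNReal.ofReal (Real.exp (-t * ∑ i, Z i s ^ 2)) ∂P =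
          ENNReal.ofReal ((1 + 2 * t) ^ (-((d : ℝ) / 2))) := fun t ht => by
      have ht := Set.mem_Ioi.mp ht
      have hb : Integrable (fun s => Real.exp (-t * ∑ i, Z i s ^ 2)) P := by
        refine Integrable.of_bound (by fun_prop) 1 (ae_of_all _ fun s => ?_)
        rw [Real.norm_eq_abs, Real.abs_exp, Real.exp_le_one_iff]
        have : 0 ≤ ∑ i, Z i s ^ 2 := Finset.sum_nonneg fun i _ => sq_nonneg _
        nlinarith
      rw [← ofReal_integral_eq_lintegral_ofReal hb (ae_of_all _ fun s => (Real.exp_pos _).le)]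
      have hc : iIndepFun (fun i s => Z i s ^ 2) P :=
        hi.comp (fun _ x => x ^ 2) fun _ => by fun_prop
      have h3 := hc.mgf_sum₀ (t := -t) (fun i => (hm i).pow_const 2) Finset.univ
      simp_rw [fun i => mgf_sq_gaussianReal (hZ i) ht.le] at h3
      rw [Finset.prod_const, Finset.card_univ, Fintype.card_fin, ← Real.rpow_mul_natCast
        (by positivity)] at h3
      rw [show -((d : ℝ) / 2) = -(1 / 2) * (d : ℝ) by ring, ← h3]
      simp [mgf]
    rw [setLIntegral_congr_fun measurableSet_Ioi h2, lintegral_one_add_two_mul_rpow]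
    · congr 2
      ring
    · have : (3 : ℝ) ≤ d := by exact_mod_cast hd
      linarith
  · have : AEMeasurable (fun q : S × ℝ => ∑ i, Z i q.1 ^ 2)
        (P.prod (volume.restrict (Set.Ioi (0 : ℝ)))) := hsum.comp_fst
    fun_prop

end Gaussian

/-! ### Distance of a Gaussian row to the span of the others -/

section Distance

open scoped ENNReal

/-- The standard Gaussian measure on row vectors. -/
def stdVec (l : ℕ) : Measure (Fin l → ℝ) := Measure.pi fun _ => gaussianReal 0 1

instance (l : ℕ) : IsProbabilityMeasure (stdVec l) := by unfold stdVec; infer_instance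

/-- The squared distance of `x` to the span of the rows `y`. -/
def distSq {k l : ℕ} (y : Fin k → Fin l → ℝ) (x : Fin l → ℝ) : ℝ≥0∞ :=
  ⨅ c : Fin k → ℝ, ENNReal.ofReal ((x - ∑ a, c a • y a) ⬝ᵥ (x - ∑ a, c a • y a))

/-- The infimum runs over uncountably many coefficients, but an infimum of continuous functions is
upper semicontinuous. -/
theorem measurable_distSq {k l : ℕ} :
    Measurable fun q : (Fin k → Fin l → ℝ) × (Fin l → ℝ) => distSq q.1 q.2 := by
  refine UpperSemicontinuous.measurable (upperSemicontinuous_iInf fun c => ?_)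
  refine Continuous.upperSemicontinuous (ENNReal.continuous_ofReal.comp ?_)
  simp only [dotProduct, Pi.sub_apply, Finset.sum_apply, Pi.smul_apply]
  fun_prop

theorem exists_orthonormal_orthogonal {k l d : ℕ} (h : k + d ≤ l) (y : Fin k → Fin l → ℝ) :
    ∃ b : Fin d → Fin l → ℝ, (∀ i j, b i ⬝ᵥ b j = if i = j then 1 else 0) ∧
      ∀ i a, b i ⬝ᵥ y a = 0 := by
  let K : Submodule ℝ (EuclideanSpace ℝ (Fin l)) :=
    Submodule.span ℝ (Set.range fun a => WithLp.toLp 2 (y a))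
  have h1 : Module.finrank ℝ K ≤ k := by
    have := finrank_range_le_card (R := ℝ) (fun a => WithLp.toLp 2 (y a))
    rwa [Fintype.card_fin] at this
  have h2 := K.finrank_add_finrank_orthogonal
  rw [finrank_euclideanSpace, Fintype.card_fin] at h2
  have h3 : d ≤ Module.finrank ℝ Kᗮ := by omega
  let e := stdOrthonormalBasis ℝ Kᗮ
  refine ⟨fun i => (e (Fin.castLE h3 i) : EuclideanSpace ℝ (Fin l)).ofLp, fun i j => ?_,
    fun i a => ?_⟩
  · have := orthonormal_iff_ite.mp e.orthonormal (Fin.castLE h3 j) (Fin.castLE h3 i)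
    rw [Submodule.coe_inner, EuclideanSpace.inner_eq_star_dotProduct] at this
    simpa [eq_comm] using this
  · have := (Submodule.mem_orthogonal K _).mp (e (Fin.castLE h3 i)).2 (WithLp.toLp 2 (y a))
      (Submodule.subset_span ⟨a, rfl⟩)
    rw [EuclideanSpace.inner_eq_star_dotProduct] at this
    simpa using this

/-- Bessel's inequality: subtracting combinations of `y` does not change the coefficients along `b`.
An inequality is enough, so the exact rank of `y` is never needed. -/
theorem le_distSq {k l d : ℕ} {y : Fin k → Fin l → ℝ} {b : Fin d → Fin l → ℝ}
    (hb : ∀ i j, b i ⬝ᵥ b j = if i = j then 1 else 0) (hy : ∀ i a, b i ⬝ᵥ y a = 0)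
    (x : Fin l → ℝ) : ENNReal.ofReal (∑ i, (b i ⬝ᵥ x) ^ 2) ≤ distSq y x := by
  refine le_iInf fun c => ENNReal.ofReal_le_ofReal ?_
  set v := x - ∑ a, c a • y a
  have h1 : ∀ i, b i ⬝ᵥ x = b i ⬝ᵥ v := fun i => by
    simp only [v, dotProduct_sub, dotProduct_sum, dotProduct_smul, hy]
    simp
  have ho : Orthonormal ℝ fun i => WithLp.toLp 2 (b i) := by
    rw [orthonormal_iff_ite]
    intro i j
    rw [EuclideanSpace.inner_toLp_toLp, star_trivial, hb]
    simp [eq_comm]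
  have h2 := ho.sum_inner_products_le (WithLp.toLp 2 v) (s := Finset.univ)
  rw [norm_toLp_sq] at h2
  refine le_trans (le_of_eq (Finset.sum_congr rfl fun i _ => ?_)) h2
  rw [EuclideanSpace.inner_toLp_toLp, star_trivial, Real.norm_eq_abs, sq_abs, h1, dotProduct_comm]

theorem stdVec_orthonormal {l : ℕ} {κ : Type*} [Fintype κ] [DecidableEq κ] {b : κ → Fin l → ℝ}
    (hb : ∀ i j, b i ⬝ᵥ b j = if i = j then 1 else 0) :
    (∀ k, HasLaw (fun x => b k ⬝ᵥ x) (gaussianReal 0 1) (stdVec l)) ∧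
      iIndepFun (fun k x => b k ⬝ᵥ x) (stdVec l) :=
  iIndepFun_orthonormal_sum (X := fun i (x : Fin l → ℝ) => x i)
    (fun i => (measurePreserving_eval (fun _ : Fin l => gaussianReal 0 1) i).hasLaw)
    (iIndepFun_pi (X := fun _ => id) fun _ => aemeasurable_id) b hb

/-- The complement of the `k` rows has room for `p + 1` orthonormal directions, and the chi-square
mean with `d = p + 1` is `1 / (p - 1)`. Here `k` counts the other rows, one fewer than the full
block. -/
theorem lintegral_inv_distSq_le {k l p : ℕ} (hp : 2 ≤ p) (h : k + (p + 1) ≤ l)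
    (y : Fin k → Fin l → ℝ) :
    ∫⁻ x, (distSq y x)⁻¹ ∂(stdVec l) ≤ ENNReal.ofReal (1 / ((p : ℝ) - 1)) := by
  obtain ⟨b, hb, hy⟩ := exists_orthonormal_orthogonal h y
  obtain ⟨h1, h2⟩ := stdVec_orthonormal hb
  calc ∫⁻ x, (distSq y x)⁻¹ ∂(stdVec l)
      ≤ ∫⁻ x, (ENNReal.ofReal (∑ i, (b i ⬝ᵥ x) ^ 2))⁻¹ ∂(stdVec l) :=
        lintegral_mono fun x => ENNReal.inv_le_inv.mpr (le_distSq hb hy x)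
    _ = ENNReal.ofReal (1 / ((p : ℝ) - 1)) := by
        rw [lintegral_inv_sum_sq (by omega) h1 h2]
        congr 2
        push_cast
        ring

/-- The component along a single unit vector orthogonal to `y` is standard normal and has no atom at
zero. -/
theorem ae_distSq_ne_zero {k l : ℕ} (h : k + 1 ≤ l) (y : Fin k → Fin l → ℝ) :
    ∀ᵐ x ∂(stdVec l), distSq y x ≠ 0 := by
  obtain ⟨b, hb, hy⟩ := exists_orthonormal_orthogonal h y
  obtain ⟨h1, -⟩ := stdVec_orthonormal hb
  have h2 : ∀ᵐ z ∂(gaussianReal 0 1), z ≠ 0 := by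
    have := nullSingletonClass_gaussianReal (μ := 0) (v := 1) one_ne_zero
    exact Measure.ae_ne _ 0
  have h3 : ∀ᵐ x ∂(stdVec l), b 0 ⬝ᵥ x ≠ 0 := by
    rw [← (h1 0).map_eq] at h2
    exact ae_of_ae_map (h1 0).aemeasurable h2
  filter_upwards [h3] with x hx h0
  have := (le_distSq hb hy x).trans_eq h0
  rw [nonpos_iff_eq_zero, ENNReal.ofReal_eq_zero] at this
  simp only [Finset.univ_unique, Fin.default_eq_zero, Finset.sum_singleton] at this
  exact absurd this (not_le.mpr (by positivity))

theorem lintegral_inv_distSq_pi_le {k l p : ℕ} (hp : 2 ≤ p) (h : k + (p + 1) ≤ l)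
    (i : Fin (k + 1)) :
    ∫⁻ y, (distSq (fun a => y (i.succAbove a)) (y i))⁻¹
      ∂(Measure.pi fun _ : Fin (k + 1) => stdVec l) ≤ ENNReal.ofReal (1 / ((p : ℝ) - 1)) := by
  have hm := measurePreserving_piFinSuccAbove (fun _ : Fin (k + 1) => stdVec l) i
  have hd : Measurable fun q : (Fin l → ℝ) × (Fin k → Fin l → ℝ) => (distSq q.2 q.1)⁻¹ :=
    (measurable_distSq.comp measurable_swap).inv
  refine (hm.lintegral_comp hd).trans_le ?_
  rw [lintegral_prod_symm _ hd.aemeasurable]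
  calc _ ≤ ∫⁻ _ : Fin k → Fin l → ℝ, ENNReal.ofReal (1 / ((p : ℝ) - 1))
        ∂(Measure.pi fun _ => stdVec l) := lintegral_mono fun y => lintegral_inv_distSq_le hp h y
    _ = _ := by simp

theorem ae_distSq_ne_zero_pi {k l : ℕ} (h : k + 1 ≤ l) (i : Fin (k + 1)) :
    ∀ᵐ y ∂(Measure.pi fun _ : Fin (k + 1) => stdVec l),
      distSq (fun a => y (i.succAbove a)) (y i) ≠ 0 := by
  have hm := measurePreserving_piFinSuccAbove (fun _ : Fin (k + 1) => stdVec l) i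
  have hd : MeasurableSet {q : (Fin k → Fin l → ℝ) × (Fin l → ℝ) | distSq q.1 q.2 ≠ 0} :=
    (measurable_distSq (measurableSet_singleton 0)).compl
  have h1 : ∀ᵐ q ∂((Measure.pi fun _ : Fin k => stdVec l).prod (stdVec l)),
      distSq q.1 q.2 ≠ 0 :=
    (Measure.ae_prod_iff_ae_ae hd).mpr (ae_of_all _ fun y => ae_distSq_ne_zero h y)
  have h2 := Measure.measurePreserving_swap (μ := stdVec l)
    (ν := Measure.pi fun _ : Fin k => stdVec l)
  exact (h2.comp hm).quasiMeasurePreserving.ae h1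

end Distance

/-! ### Inverse Gram matrices and right inverses -/

section Gram

open scoped ENNReal

variable {k l : ℕ}

/-- The right inverse `Mᵀ (M Mᵀ)⁻¹`. -/
def rightInv {t : ℕ} (M : Matrix (Fin t) (Fin l) ℝ) : Matrix (Fin l) (Fin t) ℝ :=
  Mᵀ * (M * Mᵀ)⁻¹

theorem mul_rightInv {t : ℕ} {M : Matrix (Fin t) (Fin l) ℝ} (h : (M * Mᵀ).det ≠ 0) :
    M * rightInv M = 1 := by
  rw [rightInv, ← Matrix.mul_assoc, Matrix.mul_nonsing_inv _ (isUnit_iff_ne_zero.mpr h)]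

theorem rightInv_transpose_mul_self {t : ℕ} {M : Matrix (Fin t) (Fin l) ℝ}
    (h : (M * Mᵀ).det ≠ 0) : (rightInv M)ᵀ * rightInv M = (M * Mᵀ)⁻¹ := by
  have hs : ((M * Mᵀ)⁻¹)ᵀ = (M * Mᵀ)⁻¹ := by
    rw [Matrix.transpose_nonsing_inv, Matrix.transpose_mul, Matrix.transpose_transpose]
  conv_lhs => rw [rightInv, Matrix.transpose_mul, Matrix.transpose_transpose, hs]
  rw [Matrix.mul_assoc]
  change (M * Mᵀ)⁻¹ * (M * rightInv M) = _
  rw [mul_rightInv h, Matrix.mul_one]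

theorem distSq_eq_zero_of_vecMul {M : Matrix (Fin (k + 1)) (Fin l) ℝ} {c : Fin (k + 1) → ℝ}
    (hc : c ᵥ* M = 0) {i : Fin (k + 1)} (hi : c i ≠ 0) :
    distSq (fun a => M (i.succAbove a)) (M i) = 0 := by
  refine le_antisymm (iInf_le_of_le (fun a => -(c i)⁻¹ * c (i.succAbove a)) ?_) bot_le
  have h1 : M i - ∑ a, (-(c i)⁻¹ * c (i.succAbove a)) • M (i.succAbove a) = (c i)⁻¹ • c ᵥ* M := by
    rw [Matrix.vecMul_eq_sum, Fin.sum_univ_succAbove _ i, smul_add, smul_smul,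
      inv_mul_cancel₀ hi, one_smul, Finset.smul_sum, sub_eq_add_neg, ← Finset.sum_neg_distrib]
    congr 1
    refine Finset.sum_congr rfl fun a _ => ?_
    rw [smul_smul, neg_mul, neg_smul, neg_neg]
  rw [h1, hc]
  simp

/-- A singular Gram matrix yields a linear relation among the rows; a row with nonzero coefficient
lies in the span of the others. -/
theorem det_gram_ne_zero {M : Matrix (Fin (k + 1)) (Fin l) ℝ}
    (h : ∀ i : Fin (k + 1), distSq (fun a => M (i.succAbove a)) (M i) ≠ 0) :
    (M * Mᵀ).det ≠ 0 := by
  intro h0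
  obtain ⟨c, hc, hc0⟩ := Matrix.exists_vecMul_eq_zero_iff.mpr h0
  obtain ⟨i, hi⟩ := Function.ne_iff.mp hc
  refine h i (distSq_eq_zero_of_vecMul (c := c) ?_ hi)
  rw [← dotProduct_self_eq_zero]
  have : (c ᵥ* M) ⬝ᵥ (c ᵥ* M) = (c ᵥ* (M * Mᵀ)) ⬝ᵥ c := by
    rw [← Matrix.vecMul_vecMul, Matrix.vecMul_transpose, dotProduct_comm (M *ᵥ _),
      Matrix.dotProduct_mulVec]
  rw [this, hc0, zero_dotProduct]

/-- The dual vector `w` to row `i` satisfies `M w = eᵢ` and `‖w‖² = G i i`. Dividing by `G i i`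
gives row `i` minus a combination of the other rows, of squared norm `1 / G i i`. -/
theorem ofReal_gram_inv_le {M : Matrix (Fin (k + 1)) (Fin l) ℝ} (h : (M * Mᵀ).det ≠ 0)
    (i : Fin (k + 1)) :
    ENNReal.ofReal ((M * Mᵀ)⁻¹ i i) ≤ (distSq (fun a => M (i.succAbove a)) (M i))⁻¹ := by
  set G := (M * Mᵀ)⁻¹ with hG
  have hs : Gᵀ = G := by
    rw [hG, Matrix.transpose_nonsing_inv, Matrix.transpose_mul, Matrix.transpose_transpose]
  set w := G i ᵥ* M with hw
  have hMw : M *ᵥ w = Pi.single i 1 := by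
    have : M *ᵥ w = (M * Mᵀ * G).col i := by
      rw [hw, ← Matrix.vecMul_transpose, Matrix.vecMul_vecMul]
      ext a
      rw [Matrix.col_apply, ← Matrix.transpose_apply (M * Mᵀ * G), Matrix.transpose_mul,
        Matrix.transpose_mul, Matrix.transpose_transpose, hs]
      rfl
    rw [this, hG, Matrix.mul_nonsing_inv _ (isUnit_iff_ne_zero.mpr h)]
    ext a
    simp [Matrix.one_apply, Pi.single_apply]
  have hww : w ⬝ᵥ w = G i i := by
    conv_lhs => rw [hw, ← Matrix.dotProduct_mulVec, ← hw, hMw]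
    simp
  have hpos : 0 < G i i := by
    rw [← hww]
    refine lt_of_le_of_ne (by rw [← norm_toLp_sq]; positivity) fun h0 => ?_
    rw [dotProduct_self_eq_zero.mp h0.symm, Matrix.mulVec_zero] at hMw
    simpa using congrFun hMw i
  have h1 : M i - ∑ a, (-(G i i)⁻¹ * G i (i.succAbove a)) • M (i.succAbove a) =
      (G i i)⁻¹ • w := by
    rw [hw, Matrix.vecMul_eq_sum, Fin.sum_univ_succAbove _ i, smul_add, smul_smul,
      inv_mul_cancel₀ hpos.ne', one_smul, Finset.smul_sum, sub_eq_add_neg,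
      ← Finset.sum_neg_distrib]
    congr 1
    refine Finset.sum_congr rfl fun a _ => ?_
    rw [smul_smul, neg_mul, neg_smul, neg_neg]
  rw [ENNReal.le_inv_iff_le_inv, ← ENNReal.ofReal_inv_of_pos hpos]
  refine iInf_le_of_le (fun a => -(G i i)⁻¹ * G i (i.succAbove a)) (le_of_eq ?_)
  rw [h1, smul_dotProduct, dotProduct_smul, hww]
  congr 1
  simp only [smul_eq_mul]
  field_simp

theorem ae_det_gram_ne_zero {t : ℕ} (h : t ≤ l) :
    ∀ᵐ y ∂(Measure.pi fun _ : Fin t => stdVec l),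
      (Matrix.of y * (Matrix.of y)ᵀ).det ≠ 0 := by
  cases t with
  | zero => exact ae_of_all _ fun y => by simp
  | succ k =>
    filter_upwards [ae_all_iff.mpr fun i => ae_distSq_ne_zero_pi h i] with y hy
    exact det_gram_ne_zero hy

theorem lintegral_gram_inv_le {t p : ℕ} (hp : 2 ≤ p) (h : t + p ≤ l) (i : Fin t) :
    ∫⁻ y, ENNReal.ofReal ((Matrix.of y * (Matrix.of y)ᵀ)⁻¹ i i)
      ∂(Measure.pi fun _ : Fin t => stdVec l) ≤ ENNReal.ofReal (1 / ((p : ℝ) - 1)) := by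
  cases t with
  | zero => exact i.elim0
  | succ k =>
    refine le_trans (lintegral_mono_ae ?_) (lintegral_inv_distSq_pi_le hp (by omega) i)
    filter_upwards [ae_det_gram_ne_zero (l := l) (t := k + 1) (by omega)] with y hy
    exact ofReal_gram_inv_le hy i

theorem lintegral_sq_dotProduct (w : Fin l → ℝ) :
    ∫⁻ x, ENNReal.ofReal ((w ⬝ᵥ x) ^ 2) ∂(stdVec l) = ENNReal.ofReal (w ⬝ᵥ w) := by
  by_cases hw : w ⬝ᵥ w = 0
  · rw [dotProduct_self_eq_zero.mp hw]
    simp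
  have hpos : 0 < w ⬝ᵥ w := lt_of_le_of_ne (by rw [← norm_toLp_sq]; positivity) (Ne.symm hw)
  have hs := Real.mul_self_sqrt hpos.le
  set b : Unit → Fin l → ℝ := fun _ => (√(w ⬝ᵥ w))⁻¹ • w with hb
  obtain ⟨h1, -⟩ := stdVec_orthonormal (b := b) fun i j => by
    simp only [hb, smul_dotProduct, dotProduct_smul, smul_eq_mul, Subsingleton.elim i j, if_true]
    rw [← mul_assoc, ← mul_inv, hs, inv_mul_cancel₀ hw]
  have h2 : ∀ x, ENNReal.ofReal ((w ⬝ᵥ x) ^ 2) =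
      ENNReal.ofReal (w ⬝ᵥ w) * ENNReal.ofReal ((b () ⬝ᵥ x) ^ 2) := fun x => by
    rw [← ENNReal.ofReal_mul hpos.le]
    congr 1
    simp only [hb, smul_dotProduct, smul_eq_mul]
    rw [mul_pow, inv_pow, sq (√_), hs, ← mul_assoc, mul_inv_cancel₀ hw, one_mul]
  simp_rw [h2]
  rw [lintegral_const_mul' _ _ ENNReal.ofReal_ne_top,
    (h1 ()).lintegral_comp (f := fun z => ENNReal.ofReal (z ^ 2)) (by fun_prop)]
  have h3 : ∫⁻ z, ENNReal.ofReal (z ^ 2) ∂(gaussianReal 0 1) = 1 := by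
    have hi : Integrable (fun z : ℝ => z ^ 2) (gaussianReal 0 1) :=
      (memLp_id_gaussianReal 2).integrable_sq
    rw [← ofReal_integral_eq_lintegral_ofReal hi (ae_of_all _ fun z => sq_nonneg z)]
    have := variance_of_integral_eq_zero (μ := gaussianReal 0 1) aemeasurable_id
      integral_id_gaussianReal
    rw [variance_id_gaussianReal] at this
    simp only [id] at this
    rw [← this]
    simp
  rw [h3, mul_one]

theorem measurable_mul_apply {T : Type*} [MeasurableSpace T] {a b c : ℕ}
    {X : T → Matrix (Fin a) (Fin b) ℝ} {Y : T → Matrix (Fin b) (Fin c) ℝ}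
    (hX : ∀ i j, Measurable fun t => X t i j) (hY : ∀ i j, Measurable fun t => Y t i j)
    (i : Fin a) (j : Fin c) : Measurable fun t => (X t * Y t) i j := by
  simp only [Matrix.mul_apply]
  fun_prop

theorem measurable_inv_apply {T : Type*} [MeasurableSpace T] {a : ℕ}
    {X : T → Matrix (Fin a) (Fin a) ℝ} (hX : ∀ i j, Measurable fun t => X t i j)
    (i j : Fin a) : Measurable fun t => (X t)⁻¹ i j := by
  have hX' : Measurable fun t i j => X t i j :=
    measurable_pi_iff.mpr fun i => measurable_pi_iff.mpr fun j => hX i j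
  have h1 : Continuous fun y : Fin a → Fin a → ℝ => (Matrix.of y).det :=
    Continuous.matrix_det continuous_id
  have h2 : Continuous fun y : Fin a → Fin a → ℝ => (Matrix.of y).adjugate i j :=
    (Continuous.matrix_adjugate continuous_id).matrix_elem i j
  have h3 : ∀ t, (X t)⁻¹ i j = ((X t).det)⁻¹ * (X t).adjugate i j := fun t => by
    rw [Matrix.inv_def, Ring.inverse_eq_inv', Matrix.smul_apply, smul_eq_mul]
  simp_rw [h3]
  exact ((h1.measurable.comp hX').inv).mul (h2.measurable.comp hX')

theorem measurable_rightInv {T : Type*} [MeasurableSpace T] {t : ℕ}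
    {X : T → Matrix (Fin t) (Fin l) ℝ} (hX : ∀ i j, Measurable fun s => X s i j)
    (a : Fin l) (i : Fin t) : Measurable fun s => rightInv (X s) a i := by
  have hT : ∀ i j, Measurable fun s => (X s)ᵀ i j := fun i j => hX j i
  exact measurable_mul_apply hT (measurable_inv_apply (measurable_mul_apply hX hT)) a i

/-- Row `0` is independent of the other `t` rows. Integrating it out first leaves the squared norm
of a column of the right inverse, a diagonal entry of the inverse Gram matrix. -/
theorem lintegral_sq_dotProduct_rightInv_le {t p : ℕ} (hp : 2 ≤ p) (h : t + p ≤ l) (i : Fin t) :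
    ∫⁻ y, ENNReal.ofReal (((rightInv (Matrix.of fun a => y (Fin.succ a))).col i ⬝ᵥ y 0) ^ 2)
      ∂(Measure.pi fun _ : Fin (t + 1) => stdVec l) ≤ ENNReal.ofReal (1 / ((p : ℝ) - 1)) := by
  have hm := measurePreserving_piFinSuccAbove (fun _ : Fin (t + 1) => stdVec l) 0
  have hd : Measurable fun q : (Fin l → ℝ) × (Fin t → Fin l → ℝ) =>
      ENNReal.ofReal (((rightInv (Matrix.of q.2)).col i ⬝ᵥ q.1) ^ 2) := by
    have := fun a => measurable_rightInv (l := l)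
      (X := fun q : (Fin l → ℝ) × (Fin t → Fin l → ℝ) => Matrix.of q.2)
      (fun i j => by simp only [Matrix.of_apply]; fun_prop) a i
    simp only [dotProduct, Matrix.col_apply]
    fun_prop
  refine (hm.lintegral_comp hd).trans_le ?_
  rw [lintegral_prod_symm _ hd.aemeasurable]
  refine le_trans (lintegral_mono_ae ?_) (lintegral_gram_inv_le hp h i)
  filter_upwards [ae_det_gram_ne_zero (l := l) (t := t) (by omega)] with y hy
  rw [lintegral_sq_dotProduct, ← rightInv_transpose_mul_self hy]
  rfl

end Gram

/-! ### Rotation invariance of the Gaussian matrix -/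

section Rows

theorem hasLaw_mul_of_isStdGaussianMatrix {S : Type*} [MeasurableSpace S] {P : Measure S}
    {n l t : ℕ} {Ω : S → Matrix (Fin n) (Fin l) ℝ} (hΩ : IsStdGaussianMatrix P Ω)
    {C : Matrix (Fin t) (Fin n) ℝ} (hC : C * Cᵀ = 1) :
    HasLaw (fun s a => (C * Ω s) a) (Measure.pi fun _ : Fin t => stdVec l) P := by
  have hP := hΩ.indep.isProbabilityMeasure
  -- Entry `(a, k)` of `C Ω` pairs `Ω` with the matrix having row `a` of `C` in column `k` and zeros
  -- elsewhere; these matrices are orthonormal.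
  obtain ⟨h1, h2⟩ := iIndepFun_orthonormal_sum
    (X := fun (q : Fin n × Fin l) s => Ω s q.1 q.2) (fun q => hΩ.law q.1 q.2) hΩ.indep
    (fun (a : Fin t × Fin l) (q : Fin n × Fin l) => C a.1 q.1 * if a.2 = q.2 then 1 else 0)
    (fun a b => by
      have := congrFun (congrFun hC a.1) b.1
      rw [Matrix.mul_apply, Matrix.one_apply] at this
      simp only [Matrix.transpose_apply] at this
      simp only [dotProduct, Fintype.sum_prod_type]
      have h3 : ∀ i, (∑ k, C a.1 i * (if a.2 = k then 1 else 0) *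
          (C b.1 i * if b.2 = k then 1 else 0)) =
          (C a.1 i * C b.1 i) * if a.2 = b.2 then 1 else 0 := fun i => by
        simp [eq_comm]
      simp_rw [h3]
      rw [← Finset.sum_mul, this]
      by_cases h : a.1 = b.1 <;> by_cases h' : a.2 = b.2 <;> simp [Prod.ext_iff, h, h'])
  have h3 : ∀ (a : Fin t × Fin l) s, ∑ q : Fin n × Fin l,
      C a.1 q.1 * (if a.2 = q.2 then 1 else 0) * Ω s q.1 q.2 = (C * Ω s) a.1 a.2 := fun a s => by
    rw [Fintype.sum_prod_type, Matrix.mul_apply]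
    simp
  simp_rw [h3] at h1 h2
  have h4 := h2.map_fun_eq_infinitePi_map₀' fun a => (h1 a).aemeasurable
  simp_rw [fun a => (h1 a).map_eq] at h4
  have h5 : AEMeasurable (fun s (a : Fin t × Fin l) => (C * Ω s) a.1 a.2) P :=
    aemeasurable_pi_iff.mpr fun a => (h1 a).aemeasurable
  refine ⟨aemeasurable_pi_iff.mpr fun a => aemeasurable_pi_iff.mpr fun k =>
    (h1 (a, k)).aemeasurable, ?_⟩
  -- Currying turns the product law over pairs of indices into a product of row laws.
  have h6 := Measure.infinitePi_map_curry (fun (_ : Fin t) (_ : Fin l) => gaussianReal 0 1)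
  rw [← h4, AEMeasurable.map_map_of_aemeasurable (MeasurableEquiv.measurable _).aemeasurable h5]
    at h6
  simp only [Measure.infinitePi_eq_pi] at h6
  exact h6

end Rows

/-! ### Algebra of the sketch: projection and residual -/

section Sketch

variable {m n : ℕ}

theorem misfit_transpose (A : Matrix (Fin m) (Fin n) ℝ) : (misfit A)ᵀ = misfit A := by
  rw [misfit, Matrix.transpose_mul, Matrix.transpose_transpose]

theorem dotProduct_misfit_mulVec (A : Matrix (Fin m) (Fin n) ℝ) (x y : Fin n → ℝ) :
    x ⬝ᵥ misfit A *ᵥ y = (A *ᵥ x) ⬝ᵥ (A *ᵥ y) := by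
  rw [misfit, ← Matrix.mulVec_mulVec, Matrix.dotProduct_mulVec, Matrix.vecMul_transpose]

theorem misfit_nonneg (A : Matrix (Fin m) (Fin n) ℝ) (x : Fin n → ℝ) :
    0 ≤ x ⬝ᵥ misfit A *ᵥ x := by
  rw [dotProduct_misfit_mulVec, ← norm_toLp_sq]
  positivity

theorem eq_zero_of_quadratic {M : Matrix (Fin n) (Fin n) ℝ} (hM : Mᵀ = M)
    (h0 : ∀ x, 0 ≤ x ⬝ᵥ M *ᵥ x) (h1 : ∀ x, x ⬝ᵥ M *ᵥ x ≤ 0) : M = 0 := by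
  have h2 := norm_mulVec_le_of_quadratic hM le_rfl h0 (by simpa using h1)
  refine Matrix.ext_of_mulVec_single fun i => ?_
  have := h2 (Pi.single i 1)
  rw [zero_mul, norm_le_zero_iff, WithLp.toLp_eq_zero] at this
  rw [this, Matrix.zero_mulVec]

/-- The left singular factor cancels in `WᵀW`, so the choice of the SVD is immaterial and only the
projector `Q Qᵀ` matters. -/
theorem IsRandSVDOutput.exists_sketch_eq {l : ℕ} {A : Matrix (Fin m) (Fin n) ℝ}
    {Ω : Matrix (Fin n) (Fin l) ℝ} {V : Matrix (Fin n) (Fin (min m l)) ℝ}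
    {lam : Fin (min m l) → ℝ} (h : IsRandSVDOutput A Ω V lam) :
    ∃ (Q : Matrix (Fin m) (Fin (min m l)) ℝ) (R : Matrix (Fin (min m l)) (Fin l) ℝ),
      Qᵀ * Q = 1 ∧ A * Ω = Q * R ∧ sketch V lam = Aᵀ * (Q * Qᵀ) * A := by
  obtain ⟨Q, R, U, σ, hQR, hW, hl⟩ := h
  refine ⟨Q, R, hQR.orthonormal, hQR.factor, ?_⟩
  have h1 : Aᵀ * (Q * Qᵀ) * A = ((Aᵀ * Q)ᵀ)ᵀ * (Aᵀ * Q)ᵀ := by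
    rw [Matrix.transpose_transpose, Matrix.transpose_mul, Matrix.transpose_transpose]
    simp only [Matrix.mul_assoc]
  have h2 : Matrix.diagonal lam = Matrix.diagonal σ * Matrix.diagonal σ := by
    rw [Matrix.diagonal_mul_diagonal]
    congr 1
    funext i
    rw [hl, sq]
  rw [h1, hW.factor, sketch, h2, Matrix.transpose_mul, Matrix.transpose_mul,
    Matrix.transpose_transpose, Matrix.diagonal_transpose]
  calc V * (Matrix.diagonal σ * Matrix.diagonal σ) * Vᵀ
      = V * (Matrix.diagonal σ * 1 * Matrix.diagonal σ) * Vᵀ := by rw [Matrix.mul_one]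
    _ = _ := by rw [← hW.left_orthonormal]; simp only [Matrix.mul_assoc]

/-- The properties of the sketched matrix that the error bounds depend on. -/
structure IsSketchOf {l : ℕ} (A : Matrix (Fin m) (Fin n) ℝ) (Ω : Matrix (Fin n) (Fin l) ℝ)
    (K : Matrix (Fin n) (Fin n) ℝ) : Prop where
  symm : Kᵀ = K
  nonneg : ∀ x, 0 ≤ x ⬝ᵥ K *ᵥ x
  le : ∀ x, 0 ≤ x ⬝ᵥ (misfit A - K) *ᵥ x
  residual : ∀ x z, x ⬝ᵥ (misfit A - K) *ᵥ x ≤ (x - Ω *ᵥ z) ⬝ᵥ misfit A *ᵥ (x - Ω *ᵥ z)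

theorem IsRandSVDOutput.isSketchOf {l : ℕ} {A : Matrix (Fin m) (Fin n) ℝ}
    {Ω : Matrix (Fin n) (Fin l) ℝ} {V : Matrix (Fin n) (Fin (min m l)) ℝ}
    {lam : Fin (min m l) → ℝ} (h : IsRandSVDOutput A Ω V lam) :
    IsSketchOf A Ω (sketch V lam) := by
  obtain ⟨Q, R, hQ, hY, hK⟩ := h.exists_sketch_eq
  rw [hK]
  have h1 : Aᵀ * (Q * Qᵀ) * A = misfit (Qᵀ * A) := by
    rw [misfit, Matrix.transpose_mul, Matrix.transpose_transpose]
    simp only [Matrix.mul_assoc]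
  obtain ⟨T, hT⟩ : ∃ T : Matrix (Fin m) (Fin m) ℝ, T = 1 - Q * Qᵀ := ⟨_, rfl⟩
  have hTT : Tᵀ * T = T := by
    have h2 : Q * Qᵀ * (Q * Qᵀ) = Q * Qᵀ := by
      rw [Matrix.mul_assoc, ← Matrix.mul_assoc Qᵀ, hQ, Matrix.one_mul]
    rw [hT, Matrix.transpose_sub, Matrix.transpose_one, Matrix.transpose_mul,
      Matrix.transpose_transpose, Matrix.mul_sub, Matrix.sub_mul, Matrix.sub_mul, h2]
    simp
  have hTY : T * (A * Ω) = 0 := by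
    rw [hY, hT, Matrix.sub_mul, Matrix.mul_assoc, ← Matrix.mul_assoc Qᵀ, hQ, Matrix.one_mul,
      Matrix.one_mul, sub_self]
  have h2 : misfit A - Aᵀ * (Q * Qᵀ) * A = misfit (T * A) := by
    rw [misfit, misfit, Matrix.transpose_mul, Matrix.mul_assoc Aᵀ Tᵀ, ← Matrix.mul_assoc Tᵀ, hTT,
      hT]
    simp only [Matrix.mul_sub, Matrix.sub_mul, Matrix.one_mul, Matrix.mul_assoc]
  refine ⟨by rw [h1, misfit_transpose], fun x => by rw [h1]; exact misfit_nonneg _ _,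
    fun x => by rw [h2]; exact misfit_nonneg _ _, fun x z => ?_⟩
  -- `T` annihilates the sample `A Ω`, so `z` is free; `T` is also a contraction, which allows it to
  -- be dropped afterwards.
  have h3 : (T * A) *ᵥ x = T *ᵥ (A *ᵥ (x - Ω *ᵥ z)) := by
    rw [Matrix.mulVec_mulVec, Matrix.mulVec_sub, Matrix.mulVec_mulVec, Matrix.mul_assoc, hTY,
      Matrix.zero_mulVec, sub_zero]
  set y := A *ᵥ (x - Ω *ᵥ z) with hy
  rw [h2, dotProduct_misfit_mulVec, h3, dotProduct_misfit_mulVec, ← hy]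
  have h4 : (T *ᵥ y) ⬝ᵥ (T *ᵥ y) = y ⬝ᵥ y - (Qᵀ *ᵥ y) ⬝ᵥ (Qᵀ *ᵥ y) := by
    have h5 := dotProduct_misfit_mulVec T y y
    rw [misfit, hTT] at h5
    rw [← h5, hT, Matrix.sub_mulVec, dotProduct_sub, Matrix.one_mulVec, ← Matrix.mulVec_mulVec,
      Matrix.dotProduct_mulVec y Q, ← Matrix.mulVec_transpose Q]
  have h6 : 0 ≤ (Qᵀ *ᵥ y) ⬝ᵥ (Qᵀ *ᵥ y) := by rw [← norm_toLp_sq]; positivity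
  linarith

/-- The sketched matrix is determined by the sample matrix if that has full column rank. -/
theorem IsRandSVDOutput.sketch_eq {l : ℕ} {A : Matrix (Fin m) (Fin n) ℝ}
    {Ω : Matrix (Fin n) (Fin l) ℝ} {V : Matrix (Fin n) (Fin (min m l)) ℝ}
    {lam : Fin (min m l) → ℝ} (h : IsRandSVDOutput A Ω V lam)
    (hinj : ∀ z, (A * Ω) *ᵥ z = 0 → z = 0) :
    sketch V lam = Aᵀ * (A * Ω * ((A * Ω)ᵀ * (A * Ω))⁻¹ * (A * Ω)ᵀ) * A := by
  obtain ⟨Q, R, hQ, hY, hK⟩ := h.exists_sketch_eq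
  have hYY : (A * Ω)ᵀ * (A * Ω) = Rᵀ * R := by
    rw [hY, Matrix.transpose_mul, Matrix.mul_assoc, ← Matrix.mul_assoc Qᵀ, hQ, Matrix.one_mul]
  have hRinj : ∀ z, R *ᵥ z = 0 → z = 0 := fun z hz => hinj z (by
    rw [hY, ← Matrix.mulVec_mulVec, hz, Matrix.mulVec_zero])
  have hdet : IsUnit (Rᵀ * R).det := by
    rw [isUnit_iff_ne_zero]
    intro h0
    obtain ⟨v, hv, hv0⟩ := Matrix.exists_mulVec_eq_zero_iff.mpr h0
    refine hv (hRinj v ?_)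
    have := dotProduct_misfit_mulVec R v v
    rw [misfit, hv0, dotProduct_zero] at this
    exact dotProduct_self_eq_zero.mp this.symm
  -- Injectivity of `R` forces it to be square, so its left inverse is also a right inverse.
  have hcard : l = min m l := by
    refine le_antisymm ?_ (min_le_right _ _)
    have := LinearMap.finrank_le_finrank_of_injective (f := Matrix.toLin' R)
      ((injective_iff_map_eq_zero _).mpr fun z hz => hRinj z (by simpa using hz))
    simpa using this
  have hL : (Rᵀ * R)⁻¹ * Rᵀ * R = 1 := by
    rw [Matrix.mul_assoc, Matrix.nonsing_inv_mul _ hdet]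
  have hR : R * ((Rᵀ * R)⁻¹ * Rᵀ) = 1 :=
    (Matrix.mul_eq_one_comm_of_equiv (finCongr hcard)).mp hL
  rw [hK, hYY, hY, Matrix.transpose_mul]
  congr 2
  calc Q * Qᵀ = Q * (1 : Matrix (Fin (min m l)) (Fin (min m l)) ℝ) * Qᵀ := by
        rw [Matrix.mul_one]
    _ = _ := by rw [← hR]; simp only [Matrix.mul_assoc]

end Sketch

/-! ### Eigenvector coordinates and ordered eigenvalues -/

section Spectral

variable {m n : ℕ}

theorem exists_eig_decomposition (A : Matrix (Fin m) (Fin n) ℝ) :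
    ∃ B : Matrix (Fin n) (Fin n) ℝ, B * Bᵀ = 1 ∧
      misfit A = Bᵀ * Matrix.diagonal (fun j : Fin n => eig A j) * B := by
  set hA := misfit_isHermitian A
  -- The eigenvector basis is indexed through an arbitrary bijection; `e` aligns it with the
  -- decreasing order used by `eig`.
  let e : Fin n ≃ Fin n :=
    (finCongr (Fintype.card_fin n).symm).trans (Fintype.equivOfCardEq (Fintype.card_fin _))
  let B : Matrix (Fin n) (Fin n) ℝ := Matrix.of fun j => (hA.eigenvectorBasis (e j)).ofLp
  have h1 : B * Bᵀ = 1 := by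
    ext j k
    have := orthonormal_iff_ite.mp hA.eigenvectorBasis.orthonormal (e k) (e j)
    rw [EuclideanSpace.inner_eq_star_dotProduct, star_trivial] at this
    rw [Matrix.mul_apply', Matrix.one_apply]
    simp only [e.injective.eq_iff] at this
    simpa only [eq_comm (a := k)] using! this
  have h2 : ∀ j : Fin n, hA.eigenvalues (e j) = eig A j := fun j => by
    have : (j : ℕ) < Fintype.card (Fin n) := by simp
    simp only [Matrix.IsHermitian.eigenvalues, eig, this, dif_pos, e, Equiv.trans_apply,
      Equiv.symm_apply_apply]
    rfl
  have h3 : misfit A * Bᵀ = Bᵀ * Matrix.diagonal (fun j : Fin n => eig A j) := by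
    ext i j
    have := congrFun (hA.mulVec_eigenvectorBasis (e j)) i
    rw [h2] at this
    rw [Matrix.mul_diagonal, Matrix.mul_apply', mul_comm]
    exact this
  refine ⟨B, h1, ?_⟩
  rw [← h3, Matrix.mul_assoc, mul_eq_one_comm.mp h1, Matrix.mul_one]

theorem eig_of_le (A : Matrix (Fin m) (Fin n) ℝ) {j : ℕ} (h : n ≤ j) : eig A j = 0 := by
  rw [eig, dif_neg (by simpa using h)]

theorem quadratic_eig {A : Matrix (Fin m) (Fin n) ℝ} {B : Matrix (Fin n) (Fin n) ℝ}
    (h : misfit A = Bᵀ * Matrix.diagonal (fun j : Fin n => eig A j) * B) (x : Fin n → ℝ) :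
    x ⬝ᵥ misfit A *ᵥ x = ∑ j : Fin n, eig A j * (B *ᵥ x) j ^ 2 := by
  rw [h, ← Matrix.mulVec_mulVec, ← Matrix.mulVec_mulVec, Matrix.dotProduct_mulVec,
    Matrix.vecMul_transpose]
  simp only [dotProduct, Matrix.mulVec_diagonal]
  exact Finset.sum_congr rfl fun j _ => by ring

theorem eig_nonneg (A : Matrix (Fin m) (Fin n) ℝ) (j : ℕ) : 0 ≤ eig A j := by
  rcases lt_or_ge j n with hj | hj
  · obtain ⟨B, hB, h⟩ := exists_eig_decomposition A
    have h1 := misfit_nonneg A (Bᵀ *ᵥ Pi.single ⟨j, hj⟩ 1)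
    rw [quadratic_eig h, Matrix.mulVec_mulVec, hB, Matrix.one_mulVec] at h1
    simpa [Pi.single_apply] using h1
  · rw [eig_of_le A hj]

theorem eig_anti (A : Matrix (Fin m) (Fin n) ℝ) {i j : ℕ} (hij : i ≤ j) : eig A j ≤ eig A i := by
  rcases lt_or_ge j n with hj | hj
  · rw [eig, eig, dif_pos (by simpa using hj), dif_pos (by simpa using hij.trans_lt hj)]
    exact (misfit_isHermitian A).eigenvalues₀_antitone hij
  · rw [eig_of_le A hj]
    exact eig_nonneg A i

end Spectral

/-! ### Pathwise bound on the residual -/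

section Residual

theorem sum_weighted_sq_sub_le {ι κ : Type*} [Fintype κ] (T : Finset ι) {w : ι → ℝ} {L : ℝ}
    (h0 : ∀ j ∈ T, 0 ≤ w j) (hL : ∀ j ∈ T, w j ≤ L) (hL0 : 0 ≤ L) (a : ι → ℝ) (c : ι → κ → ℝ)
    (b : κ → ℝ) :
    ∑ j ∈ T, w j * (a j - ∑ i, c j i * b i) ^ 2 ≤
      (L + ∑ j ∈ T, ∑ i, w j * c j i ^ 2) * (∑ j ∈ T, a j ^ 2 + ∑ i, b i ^ 2) := by
  set v : ι → ℝ := fun j => ∑ i, c j i * b i with hv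
  set F := ∑ j ∈ T, ∑ i, w j * c j i ^ 2 with hF
  set α := ∑ j ∈ T, a j ^ 2
  set β := ∑ i, b i ^ 2
  have hα : 0 ≤ α := Finset.sum_nonneg fun j _ => sq_nonneg _
  have hβ : 0 ≤ β := Finset.sum_nonneg fun j _ => sq_nonneg _
  have hF0 : 0 ≤ F := Finset.sum_nonneg fun j hj => Finset.sum_nonneg fun i _ =>
    mul_nonneg (h0 j hj) (sq_nonneg _)
  have hS : ∑ j ∈ T, w j * a j ^ 2 ≤ L * α := by
    rw [Finset.mul_sum]
    exact Finset.sum_le_sum fun j hj => mul_le_mul_of_nonneg_right (hL j hj) (sq_nonneg _)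
  have hU : ∑ j ∈ T, w j * v j ^ 2 ≤ F * β := by
    rw [hF, Finset.sum_mul]
    refine Finset.sum_le_sum fun j hj => ?_
    rw [← Finset.mul_sum, mul_assoc]
    exact mul_le_mul_of_nonneg_left (Finset.sum_mul_sq_le_sq_mul_sq _ _ _) (h0 j hj)
  have hS0 : 0 ≤ ∑ j ∈ T, w j * a j ^ 2 := Finset.sum_nonneg fun j hj =>
    mul_nonneg (h0 j hj) (sq_nonneg _)
  have hU0 : 0 ≤ ∑ j ∈ T, w j * v j ^ 2 := Finset.sum_nonneg fun j hj =>
    mul_nonneg (h0 j hj) (sq_nonneg _)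
  have hC : (∑ j ∈ T, w j * (a j * v j)) ^ 2 ≤
      (∑ j ∈ T, w j * a j ^ 2) * ∑ j ∈ T, w j * v j ^ 2 := by
    have := Finset.sum_mul_sq_le_sq_mul_sq T (fun j => √(w j) * a j) (fun j => √(w j) * v j)
    have e1 : ∑ j ∈ T, w j * (a j * v j) = ∑ j ∈ T, √(w j) * a j * (√(w j) * v j) :=
      Finset.sum_congr rfl fun j hj => by
        conv_lhs => rw [← Real.mul_self_sqrt (h0 j hj)]
        ring
    have e2 : ∀ f : ι → ℝ, ∑ j ∈ T, w j * f j ^ 2 = ∑ j ∈ T, (√(w j) * f j) ^ 2 := fun f =>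
      Finset.sum_congr rfl fun j hj => by rw [mul_pow, Real.sq_sqrt (h0 j hj)]
    rw [e1, e2, e2]
    exact this
  have hexp : ∑ j ∈ T, w j * (a j - v j) ^ 2 = ∑ j ∈ T, w j * a j ^ 2 +
      ∑ j ∈ T, w j * v j ^ 2 - 2 * ∑ j ∈ T, w j * (a j * v j) := by
    rw [Finset.mul_sum, ← Finset.sum_add_distrib, ← Finset.sum_sub_distrib]
    exact Finset.sum_congr rfl fun j _ => by ring
  -- Regroup `(L α)(F β)` as `(L β)(F α)` before AM-GM: the cross term then supplies exactly the
  -- terms missing from `(L + F)(α + β)`.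
  have hX : (2 * ∑ j ∈ T, w j * (a j * v j)) ^ 2 ≤ (L * β + F * α) ^ 2 := by
    have h1 := mul_le_mul hS hU hU0 (mul_nonneg hL0 hα)
    nlinarith [sq_nonneg (L * β - F * α)]
  have hX' := (abs_le_of_sq_le_sq' hX (by positivity)).1
  rw [hexp]
  linarith

variable {m n l : ℕ}

/-- The first `t` rows of a matrix. -/
def topRows {t : ℕ} (ht : t ≤ n) (N : Matrix (Fin n) (Fin l) ℝ) : Matrix (Fin t) (Fin l) ℝ :=
  N.submatrix (Fin.castLE ht) id

/-- The contribution of the trailing eigenvalues to the error, for the sample matrix `N` in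
eigenvector coordinates. -/
def tailError {t : ℕ} (A : Matrix (Fin m) (Fin n) ℝ) (ht : t ≤ n)
    (N : Matrix (Fin n) (Fin l) ℝ) : ℝ :=
  ∑ j ∈ Finset.univ.filter (fun j : Fin n => t ≤ j),
    ∑ i, eig A j * ((rightInv (topRows ht N)).col i ⬝ᵥ N j) ^ 2

theorem tailError_nonneg {t : ℕ} (A : Matrix (Fin m) (Fin n) ℝ) (ht : t ≤ n)
    (N : Matrix (Fin n) (Fin l) ℝ) : 0 ≤ tailError A ht N :=
  Finset.sum_nonneg fun _ _ => Finset.sum_nonneg fun _ _ =>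
    mul_nonneg (eig_nonneg A _) (sq_nonneg _)

theorem sum_castLE_eq_sum_filter {t : ℕ} (ht : t ≤ n) (f : Fin n → ℝ) :
    ∑ i : Fin t, f (Fin.castLE ht i) = ∑ j ∈ Finset.univ.filter (fun j : Fin n => ¬ t ≤ j), f j := by
  refine Finset.sum_bij (fun i _ => Fin.castLE ht i) (fun i _ => by simp)
    (fun i _ j _ h => Fin.castLE_injective ht h) (fun j hj => ?_) fun _ _ => rfl
  have hj : (j : ℕ) < t := by simpa using hj
  exact ⟨⟨j, hj⟩, Finset.mem_univ _, rfl⟩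

/-- The residual bound is used at `z = W b`, where `b` holds the first `t` coordinates of `B x`:
this cancels them, so only eigenvalues from the zero-based index `t` on remain. -/
theorem IsSketchOf.quadratic_le {A : Matrix (Fin m) (Fin n) ℝ} {Ω : Matrix (Fin n) (Fin l) ℝ}
    {K B : Matrix (Fin n) (Fin n) ℝ} (hK : IsSketchOf A Ω K) (hB : B * Bᵀ = 1)
    (hAB : misfit A = Bᵀ * Matrix.diagonal (fun j : Fin n => eig A j) * B) {t : ℕ} (ht : t ≤ n)
    (hdet : (topRows ht (B * Ω) * (topRows ht (B * Ω))ᵀ).det ≠ 0) (x : Fin n → ℝ) :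
    x ⬝ᵥ (misfit A - K) *ᵥ x ≤ (eig A t + tailError A ht (B * Ω)) * (x ⬝ᵥ x) := by
  set N := B * Ω with hN
  set W := rightInv (topRows ht N) with hW
  set a := B *ᵥ x with ha
  set b : Fin t → ℝ := fun i => a (Fin.castLE ht i) with hb
  have hNW : topRows ht N *ᵥ (W *ᵥ b) = b := by
    rw [Matrix.mulVec_mulVec, mul_rightInv hdet, Matrix.one_mulVec]
  have hres := hK.residual x (W *ᵥ b)
  have hcoord : B *ᵥ (x - Ω *ᵥ (W *ᵥ b)) = a - N *ᵥ (W *ᵥ b) := by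
    rw [Matrix.mulVec_sub, Matrix.mulVec_mulVec]
  rw [quadratic_eig hAB, hcoord, ← Finset.sum_filter_add_sum_filter_not Finset.univ
    (fun j : Fin n => t ≤ j)] at hres
  have hzero : ∑ j ∈ Finset.univ.filter (fun j : Fin n => ¬ t ≤ j),
      eig A j * (a - N *ᵥ (W *ᵥ b)) j ^ 2 = 0 := by
    rw [← sum_castLE_eq_sum_filter ht]
    refine Finset.sum_eq_zero fun i _ => ?_
    have : (N *ᵥ (W *ᵥ b)) (Fin.castLE ht i) = b i := congrFun hNW i
    rw [Pi.sub_apply, this, hb]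
    simp
  have hrow : ∀ j, (N *ᵥ (W *ᵥ b)) j = ∑ i, (W.col i ⬝ᵥ N j) * b i := fun j => by
    have h1 : ((N * W) *ᵥ b) j = ∑ i, (N * W) j i * b i := rfl
    rw [Matrix.mulVec_mulVec, h1]
    refine Finset.sum_congr rfl fun i _ => ?_
    rw [Matrix.mul_apply', dotProduct_comm]
    rfl
  have hmain := sum_weighted_sq_sub_le (Finset.univ.filter fun j : Fin n => t ≤ j)
    (w := fun j => eig A j) (L := eig A t) (fun j _ => eig_nonneg A j)
    (fun j hj => eig_anti A (Finset.mem_filter.mp hj).2) (eig_nonneg A t) a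
    (fun j i => W.col i ⬝ᵥ N j) b
  have hsum : ∑ j ∈ Finset.univ.filter (fun j : Fin n => t ≤ j), a j ^ 2 + ∑ i, b i ^ 2 =
      x ⬝ᵥ x := by
    rw [hb, sum_castLE_eq_sum_filter ht (fun j => a j ^ 2), Finset.sum_filter_add_sum_filter_not]
    have h1 : a ⬝ᵥ a = x ⬝ᵥ x := by
      rw [ha, Matrix.dotProduct_mulVec, ← Matrix.mulVec_transpose, Matrix.mulVec_mulVec,
        mul_eq_one_comm.mp hB, Matrix.one_mulVec]
    rw [← h1]
    simp [dotProduct, sq]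
  rw [hsum] at hmain
  rw [hzero, add_zero] at hres
  simp only [Pi.sub_apply, hrow] at hres
  exact hres.trans hmain

theorem eigTail_eq_sum_filter (A : Matrix (Fin m) (Fin n) ℝ) (t : ℕ) :
    eigTail A t = ∑ j ∈ Finset.univ.filter (fun j : Fin n => t ≤ j), eig A j := by
  rw [Finset.sum_filter, Fin.sum_univ_eq_sum_range (fun j => if t ≤ j then eig A j else 0) n,
    ← Finset.sum_filter, eigTail]
  congr 1
  ext j
  simp [and_comm]

end Residual

/-! ### Expectation of the trailing error -/

section Expectation

open scoped ENNReal

variable {S : Type*} [MeasurableSpace S] {P : Measure S} {m n l : ℕ}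
  {Ω : S → Matrix (Fin n) (Fin l) ℝ} {B : Matrix (Fin n) (Fin n) ℝ}

theorem hasLaw_rows (hΩ : IsStdGaussianMatrix P Ω) (hB : B * Bᵀ = 1) {t : ℕ} {g : Fin t → Fin n}
    (hg : Function.Injective g) :
    HasLaw (fun s a => (B * Ω s) (g a)) (Measure.pi fun _ : Fin t => stdVec l) P := by
  refine hasLaw_mul_of_isStdGaussianMatrix hΩ (C := B.submatrix g id) ?_
  ext a b
  have := congrFun (congrFun hB (g a)) (g b)
  rw [Matrix.one_apply] at this ⊢
  simp only [hg.eq_iff] at this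
  exact this

theorem ae_det_topRows_ne_zero (hΩ : IsStdGaussianMatrix P Ω) (hB : B * Bᵀ = 1) {t : ℕ}
    (ht : t ≤ n) (htl : t ≤ l) :
    ∀ᵐ s ∂P, (topRows ht (B * Ω s) * (topRows ht (B * Ω s))ᵀ).det ≠ 0 := by
  have h1 := hasLaw_rows hΩ hB (Fin.castLE_injective ht)
  have h2 := ae_det_gram_ne_zero htl
  rw [← h1.map_eq] at h2
  exact ae_of_ae_map h1.aemeasurable h2

theorem measurable_sq_dotProduct_rightInv {T : Type*} [MeasurableSpace T] {t : ℕ}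
    {X : T → Matrix (Fin t) (Fin l) ℝ} {Y : T → Fin l → ℝ}
    (hX : ∀ i j, Measurable fun s => X s i j) (hY : ∀ j, Measurable fun s => Y s j) (i : Fin t) :
    Measurable fun s => ((rightInv (X s)).col i ⬝ᵥ Y s) ^ 2 := by
  have := fun a => measurable_rightInv hX a i
  simp only [dotProduct, Matrix.col_apply]
  fun_prop

theorem aemeasurable_entries (hΩ : IsStdGaussianMatrix P Ω) :
    AEMeasurable (fun s i j => Ω s i j) P :=
  aemeasurable_pi_iff.mpr fun i => aemeasurable_pi_iff.mpr fun j => (hΩ.law i j).aemeasurable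

theorem lintegral_sq_dotProduct_topRows_le (hΩ : IsStdGaussianMatrix P Ω) (hB : B * Bᵀ = 1)
    {t p : ℕ} (hp : 2 ≤ p) (ht : t ≤ n) (htp : t + p ≤ l) (i : Fin t) {j : Fin n} (hj : t ≤ j) :
    ∫⁻ s, ENNReal.ofReal (((rightInv (topRows ht (B * Ω s))).col i ⬝ᵥ (B * Ω s) j) ^ 2) ∂P ≤
      ENNReal.ofReal (1 / ((p : ℝ) - 1)) := by
  -- Puts the trailing row `j` in position `0`, ahead of the leading rows; `t ≤ j` makes it distinct
  -- from them.
  have hg : Function.Injective (Fin.cons j (Fin.castLE ht) : Fin (t + 1) → Fin n) := by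
    rw [Fin.cons_injective_iff]
    refine ⟨?_, Fin.castLE_injective ht⟩
    rintro ⟨a, rfl⟩
    exact absurd hj (by simp)
  have h1 := hasLaw_rows hΩ hB hg
  have hm : Measurable fun y : Fin (t + 1) → Fin l → ℝ => ENNReal.ofReal
      (((rightInv (Matrix.of fun a => y (Fin.succ a))).col i ⬝ᵥ y 0) ^ 2) :=
    (measurable_sq_dotProduct_rightInv
      (X := fun y : Fin (t + 1) → Fin l → ℝ => Matrix.of fun a => y (Fin.succ a))
      (fun i j => by simp only [Matrix.of_apply]; fun_prop) (fun j => by fun_prop) i).ennreal_ofReal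
  exact (h1.lintegral_comp hm.aemeasurable).trans_le (lintegral_sq_dotProduct_rightInv_le hp htp i)

theorem aemeasurable_sq_dotProduct_topRows (hΩ : IsStdGaussianMatrix P Ω) {t : ℕ} (ht : t ≤ n)
    (i : Fin t) (j : Fin n) :
    AEMeasurable (fun s => ((rightInv (topRows ht (B * Ω s))).col i ⬝ᵥ (B * Ω s) j) ^ 2) P := by
  have hN : ∀ i j, Measurable fun y : Fin n → Fin l → ℝ => (B * Matrix.of y) i j :=
    measurable_mul_apply (X := fun _ => B) (Y := fun y => Matrix.of y)
      (fun _ _ => measurable_const) (fun i j => by simp only [Matrix.of_apply]; fun_prop)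
  exact (measurable_sq_dotProduct_rightInv
    (X := fun y : Fin n → Fin l → ℝ => topRows ht (B * Matrix.of y))
    (Y := fun y => (B * Matrix.of y) j) (fun a b => hN _ b) (hN j) i).comp_aemeasurable
      (aemeasurable_entries hΩ)

/-- The expectation of the trailing error. -/
theorem integral_tailError_le (hΩ : IsStdGaussianMatrix P Ω) (hB : B * Bᵀ = 1)
    (A : Matrix (Fin m) (Fin n) ℝ) {t p : ℕ} (hp : 2 ≤ p) (ht : t ≤ n) (htp : t + p ≤ l) :
    Integrable (fun s => tailError A ht (B * Ω s)) P ∧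
      ∫ s, tailError A ht (B * Ω s) ∂P ≤ (t : ℝ) / ((p : ℝ) - 1) * eigTail A t := by
  have hp1 : 0 < (p : ℝ) - 1 := by
    have : (2 : ℝ) ≤ p := by exact_mod_cast hp
    linarith
  have key : ∀ (i : Fin t) (j : Fin n), t ≤ j →
      Integrable (fun s => ((rightInv (topRows ht (B * Ω s))).col i ⬝ᵥ (B * Ω s) j) ^ 2) P ∧
      ∫ s, ((rightInv (topRows ht (B * Ω s))).col i ⬝ᵥ (B * Ω s) j) ^ 2 ∂P ≤
        1 / ((p : ℝ) - 1) := fun i j hj => by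
    have h1 := (aemeasurable_sq_dotProduct_topRows (B := B) hΩ ht i j).aestronglyMeasurable
    have h2 := lintegral_sq_dotProduct_topRows_le hΩ hB hp ht htp i hj
    refine ⟨⟨h1, ?_⟩, ?_⟩
    · rw [hasFiniteIntegral_iff_ofReal (ae_of_all _ fun s => sq_nonneg _)]
      exact h2.trans_lt ENNReal.ofReal_lt_top
    · rw [integral_eq_lintegral_of_nonneg_ae (ae_of_all _ fun s => sq_nonneg _) h1]
      exact ENNReal.toReal_le_of_le_ofReal (by positivity) h2
  have hI : ∀ j ∈ Finset.univ.filter (fun j : Fin n => t ≤ j), ∀ i ∈ (Finset.univ : Finset (Fin t)),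
      Integrable (fun s => eig A j *
        ((rightInv (topRows ht (B * Ω s))).col i ⬝ᵥ (B * Ω s) j) ^ 2) P := fun j hj i _ =>
    (key i j (Finset.mem_filter.mp hj).2).1.const_mul _
  refine ⟨integrable_finsetSum _ fun j hj => integrable_finsetSum _ (hI j hj), ?_⟩
  simp only [tailError]
  rw [integral_finsetSum _ fun j hj => integrable_finsetSum _ (hI j hj), eigTail_eq_sum_filter,
    Finset.mul_sum]
  refine Finset.sum_le_sum fun j hj => ?_
  rw [integral_finsetSum _ (hI j hj)]
  calc _ ≤ ∑ _i : Fin t, eig A j * (1 / ((p : ℝ) - 1)) := Finset.sum_le_sum fun i _ => by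
        rw [integral_const_mul]
        exact mul_le_mul_of_nonneg_left (key i j (Finset.mem_filter.mp hj).2).2 (eig_nonneg A j)
    _ = _ := by
        rw [Finset.sum_const, Finset.card_univ, Fintype.card_fin, nsmul_eq_mul]
        ring

end Expectation

/-! ### Measurability independent of the chosen factorizations -/

section Measurability

variable {S : Type*} [MeasurableSpace S] {P : Measure S} {m n l : ℕ}
  {Ω : S → Matrix (Fin n) (Fin l) ℝ}

/-- The sketched matrix is almost surely a measurable function of the test matrix, whatever
factorizations are chosen. -/
theorem exists_measurable_sketch (hΩ : IsStdGaussianMatrix P Ω) {A : Matrix (Fin m) (Fin n) ℝ}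
    {V : S → Matrix (Fin n) (Fin (min m l)) ℝ} {lam : S → Fin (min m l) → ℝ}
    (hout : ∀ᵐ s ∂P, IsRandSVDOutput A (Ω s) (V s) (lam s)) :
    ∃ F : (Fin n → Fin l → ℝ) → Matrix (Fin n) (Fin n) ℝ,
      (∀ i j, Measurable fun y => F y i j) ∧
        ∀ᵐ s ∂P, sketch (V s) (lam s) = F (fun i j => Ω s i j) := by
  obtain ⟨B, hB, hAB⟩ := exists_eig_decomposition A
  by_cases hl : eig A l = 0
  -- If `λ_{l+1} = 0`, the residual bound with `t = min l n` has constant zero, so the sketch almost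
  -- surely recovers `H` exactly.
  · refine ⟨fun _ => misfit A, fun _ _ => measurable_const, ?_⟩
    have ht : min l n ≤ n := min_le_right _ _
    have he : ∀ j, min l n ≤ j → eig A j = 0 := fun j hj => by
      rcases min_le_iff.mp hj with h | h
      · exact le_antisymm (hl ▸ eig_anti A h) (eig_nonneg A j)
      · exact eig_of_le A h
    filter_upwards [hout, ae_det_topRows_ne_zero hΩ hB ht (min_le_left _ _)] with s hs hdet
    have hK := hs.isSketchOf
    have h0 : tailError A ht (B * Ω s) = 0 :=
      Finset.sum_eq_zero fun j hj => Finset.sum_eq_zero fun i _ => by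
        rw [he j (Finset.mem_filter.mp hj).2, zero_mul]
    have h1 := eq_zero_of_quadratic (M := misfit A - sketch (V s) (lam s))
      (by rw [Matrix.transpose_sub, misfit_transpose, hK.symm]) hK.le fun x => by
        have := hK.quadratic_le hB hAB ht hdet x
        rwa [h0, he _ le_rfl, add_zero, zero_mul] at this
    exact (sub_eq_zero.mp h1).symm
  -- Otherwise the first `l` eigenvalues are positive, `A Ω` is almost surely injective, and the
  -- projector onto its range has a closed formula.
  · have hln : l ≤ n := by
      by_contra h
      exact hl (eig_of_le A (le_of_not_ge h))
    refine ⟨fun y => Aᵀ * (A * Matrix.of y * ((A * Matrix.of y)ᵀ * (A * Matrix.of y))⁻¹ *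
      (A * Matrix.of y)ᵀ) * A, ?_, ?_⟩
    · have hY : ∀ i j, Measurable fun y : Fin n → Fin l → ℝ => (A * Matrix.of y) i j :=
        measurable_mul_apply (X := fun _ => A) (Y := fun y => Matrix.of y)
          (fun _ _ => measurable_const) (fun i j => by simp only [Matrix.of_apply]; fun_prop)
      have hYt : ∀ i j, Measurable fun y : Fin n → Fin l → ℝ => (A * Matrix.of y)ᵀ i j :=
        fun i j => hY j i
      exact measurable_mul_apply (measurable_mul_apply (X := fun _ => Aᵀ)
        (fun _ _ => measurable_const) (measurable_mul_apply (measurable_mul_apply hY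
          (measurable_inv_apply (measurable_mul_apply hYt hY))) hYt)) (Y := fun _ => A)
            (fun _ _ => measurable_const)
    · filter_upwards [hout, ae_det_topRows_ne_zero hΩ hB hln le_rfl] with s hs hdet
      refine hs.sketch_eq fun z hz => ?_
      have h1 : (Ω s *ᵥ z) ⬝ᵥ misfit A *ᵥ (Ω s *ᵥ z) = 0 := by
        rw [dotProduct_misfit_mulVec, Matrix.mulVec_mulVec, hz, zero_dotProduct]
      rw [quadratic_eig hAB] at h1
      replace h1 := (Finset.sum_eq_zero_iff_of_nonneg fun (j : Fin n) _ =>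
        mul_nonneg (eig_nonneg A j) (sq_nonneg ((B *ᵥ (Ω s *ᵥ z)) j))).mp h1
      have h2 : topRows hln (B * Ω s) *ᵥ z = 0 := by
        ext i
        have h3 := h1 (Fin.castLE hln i) (Finset.mem_univ _)
        have h4 : eig A i ≠ 0 := fun h => hl (le_antisymm
          (h ▸ eig_anti A i.2.le) (eig_nonneg A l))
        rw [Fin.val_castLE, mul_eq_zero, or_iff_right h4, sq_eq_zero_iff,
          Matrix.mulVec_mulVec] at h3
        exact h3
      rw [Matrix.det_mul] at hdet
      exact Matrix.eq_zero_of_mulVec_eq_zero (left_ne_zero_of_mul hdet) h2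

theorem measurable_specNorm {T : Type*} [MeasurableSpace T] {X : T → Matrix (Fin n) (Fin n) ℝ}
    (hX : ∀ i j, Measurable fun t => X t i j) : Measurable fun t => specNorm (X t) := by
  have hX' : Measurable fun t i j => X t i j :=
    measurable_pi_iff.mpr fun i => measurable_pi_iff.mpr fun j => hX i j
  let f : (Fin n → Fin n → ℝ) →ₗ[ℝ] (EuclideanSpace ℝ (Fin n) →L[ℝ] EuclideanSpace ℝ (Fin n)) :=
    (Matrix.toEuclideanCLM (n := Fin n) (𝕜 := ℝ)).toAlgEquiv.toLinearMap ∘ₗ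
      (Matrix.ofLinearEquiv ℝ).toLinearMap
  have hf : Continuous fun y => ‖f y‖ := (LinearMap.continuous_of_finiteDimensional f).norm
  exact hf.measurable.comp hX'

theorem measurable_norm_sub_mulVec {T : Type*} [MeasurableSpace T]
    {X : T → Matrix (Fin n) (Fin n) ℝ} (hX : ∀ i j, Measurable fun t => X t i j)
    (u w : Fin n → ℝ) : Measurable fun t => ‖WithLp.toLp 2 (u - X t *ᵥ w)‖ := by
  simp only [EuclideanSpace.norm_eq, Pi.sub_apply, Matrix.mulVec, dotProduct, Real.norm_eq_abs,
    sq_abs]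
  fun_prop

end Measurability

/-! ### Reduction of the steps to prior-preconditioned coordinates -/

section Steps

variable {m n : ℕ} {Γ : Matrix (Fin n) (Fin n) ℝ}

theorem weightedNorm_inv_msqrt_mulVec (hΓ : Γ.PosDef) (y : Fin n → ℝ) :
    weightedNorm Γ⁻¹ (msqrt Γ *ᵥ y) = ‖WithLp.toLp 2 y‖ := by
  have h0 : 0 ≤ Γ := Matrix.nonneg_iff_posSemidef.mpr hΓ.posSemidef
  have h1 : 0 ≤ Γ⁻¹ := Matrix.nonneg_iff_posSemidef.mpr hΓ.inv.posSemidef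
  have hu := isUnit_det_msqrt h0 ((Matrix.isUnit_iff_isUnit_det _).mp hΓ.isUnit)
  have hs := msqrt_mul_msqrt h0
  have hinv : Γ⁻¹ = (msqrt Γ)⁻¹ * (msqrt Γ)⁻¹ := by
    conv_lhs => rw [← hs]
    rw [Matrix.mul_inv_rev]
  -- Orthogonality of this product suffices for norms; the root of `Γ⁻¹` need not be identified with
  -- the inverse of the root of `Γ`.
  have e1 : (msqrt Γ⁻¹ * msqrt Γ)ᵀ * (msqrt Γ⁻¹ * msqrt Γ) = 1 := by
    rw [Matrix.transpose_mul, msqrt_transpose, msqrt_transpose, Matrix.mul_assoc,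
      ← Matrix.mul_assoc (msqrt Γ⁻¹), msqrt_mul_msqrt h1, hinv, Matrix.mul_assoc,
      Matrix.nonsing_inv_mul _ hu, Matrix.mul_one, Matrix.mul_nonsing_inv _ hu]
  rw [weightedNorm, Matrix.mulVec_mulVec]
  have e2 := dotProduct_misfit_mulVec (msqrt Γ⁻¹ * msqrt Γ) y y
  rw [misfit, e1, Matrix.one_mulVec, ← norm_toLp_sq, ← norm_toLp_sq] at e2
  exact ((sq_eq_sq₀ (norm_nonneg _) (norm_nonneg _)).mp e2).symm

theorem gnStep_eq (hΓ : Γ.PosDef) (G : Matrix (Fin m) (Fin n) ℝ) (g : Fin n → ℝ) :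
    gnStep Γ G g = msqrt Γ *ᵥ -((1 + misfit (precondOp Γ G))⁻¹ *ᵥ (msqrt Γ *ᵥ g)) := by
  have h0 : 0 ≤ Γ := Matrix.nonneg_iff_posSemidef.mpr hΓ.posSemidef
  have hu := isUnit_det_msqrt h0 ((Matrix.isUnit_iff_isUnit_det _).mp hΓ.isUnit)
  have hs := msqrt_mul_msqrt h0
  have hH : gnHessian Γ G = (msqrt Γ)⁻¹ * (1 + misfit (precondOp Γ G)) * (msqrt Γ)⁻¹ := by
    have h1 : Γ⁻¹ = (msqrt Γ)⁻¹ * (msqrt Γ)⁻¹ := by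
      conv_lhs => rw [← hs]
      rw [Matrix.mul_inv_rev]
    have h2 : (msqrt Γ)⁻¹ * misfit (precondOp Γ G) * (msqrt Γ)⁻¹ = Gᵀ * G := by
      rw [misfit, precondOp, Matrix.transpose_mul, msqrt_transpose]
      calc _ = ((msqrt Γ)⁻¹ * msqrt Γ) * Gᵀ * G * (msqrt Γ * (msqrt Γ)⁻¹) := by
            simp only [Matrix.mul_assoc]
        _ = _ := by
            rw [Matrix.nonsing_inv_mul _ hu, Matrix.mul_nonsing_inv _ hu, Matrix.one_mul,
              Matrix.mul_one]
    rw [gnHessian, Matrix.mul_add, Matrix.add_mul, Matrix.mul_one, h2, h1]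
  rw [gnStep, hH, Matrix.mul_inv_rev, Matrix.mul_inv_rev, Matrix.nonsing_inv_nonsing_inv _ hu,
    Matrix.mulVec_neg, ← Matrix.mulVec_mulVec, ← Matrix.mulVec_mulVec]

theorem sketchSolvStep_eq (K : Matrix (Fin n) (Fin n) ℝ) (g : Fin n → ℝ) :
    sketchSolvStep Γ K g = msqrt Γ *ᵥ -((1 + K)⁻¹ *ᵥ (msqrt Γ *ᵥ g)) := by
  rw [sketchSolvStep, Matrix.mulVec_neg, ← Matrix.mulVec_mulVec, ← Matrix.mulVec_mulVec]

theorem weightedNorm_step_ratio_eq (hΓ : Γ.PosDef) (G : Matrix (Fin m) (Fin n) ℝ)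
    (K : Matrix (Fin n) (Fin n) ℝ) (g : Fin n → ℝ) :
    weightedNorm Γ⁻¹ (gnStep Γ G g - sketchSolvStep Γ K g) / weightedNorm Γ⁻¹ (gnStep Γ G g) =
      ‖WithLp.toLp 2 ((1 + misfit (precondOp Γ G))⁻¹ *ᵥ (msqrt Γ *ᵥ g) -
        (1 + K)⁻¹ *ᵥ (msqrt Γ *ᵥ g))‖ /
      ‖WithLp.toLp 2 ((1 + misfit (precondOp Γ G))⁻¹ *ᵥ (msqrt Γ *ᵥ g))‖ := by
  rw [gnStep_eq hΓ, sketchSolvStep_eq, ← Matrix.mulVec_sub, weightedNorm_inv_msqrt_mulVec hΓ,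
    weightedNorm_inv_msqrt_mulVec hΓ, WithLp.toLp_neg, norm_neg, ← neg_sub', WithLp.toLp_neg,
    norm_neg]

end Steps

theorem integral_le_of_ae_le_const_add {S : Type*} [MeasurableSpace S] {P : Measure S}
    [IsProbabilityMeasure P] {f E : S → ℝ} {a b : ℝ} (hf : AEMeasurable f P)
    (h0 : ∀ s, 0 ≤ f s) (hle : ∀ᵐ s ∂P, f s ≤ a + E s) (hE : Integrable E P)
    (hb : ∫ s, E s ∂P ≤ b) : Integrable f P ∧ ∫ s, f s ∂P ≤ a + b := by
  have hi : Integrable (fun s => a + E s) P := (integrable_const a).add hE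
  have hfi : Integrable f P := hi.mono' hf.aestronglyMeasurable (by
    filter_upwards [hle] with s hs
    rwa [Real.norm_of_nonneg (h0 s)])
  refine ⟨hfi, (integral_mono_ae hfi hi hle).trans ?_⟩
  rw [integral_add (integrable_const a) hE]
  simpa using hb

end RandSketch

end

/-! ### Assembly of the expectation bounds -/

open RandSketch in
theorem theorem1 {S : Type*} [MeasurableSpace S] (P : Measure S) [IsProbabilityMeasure P]
    {m n : ℕ} (hmn : m ≤ n) (r p : ℕ) (hr : r ≤ m) (hp : 2 ≤ p)
    (Γ : Matrix (Fin n) (Fin n) ℝ) (hΓ : Γ.PosDef) (G : Matrix (Fin m) (Fin n) ℝ)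
    (Ω : S → Matrix (Fin n) (Fin (r + p)) ℝ) (hΩ : IsStdGaussianMatrix P Ω)
    (V : S → Matrix (Fin n) (Fin (min m (r + p))) ℝ) (lam : S → Fin (min m (r + p)) → ℝ)
    (hout : ∀ᵐ s ∂P, IsRandSVDOutput (precondOp Γ G) (Ω s) (V s) (lam s)) :
    (∀ g : Fin n → ℝ, g ≠ 0 →
      Integrable (fun s => weightedNorm Γ⁻¹
          (gnStep Γ G g - sketchSolvStep Γ (sketch (V s) (lam s)) g) /
            weightedNorm Γ⁻¹ (gnStep Γ G g)) P ∧
      ∫ s, weightedNorm Γ⁻¹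
          (gnStep Γ G g - sketchSolvStep Γ (sketch (V s) (lam s)) g) /
            weightedNorm Γ⁻¹ (gnStep Γ G g) ∂P
        ≤ Psi (precondOp Γ G) r p) ∧
    (Integrable (fun s => condNum
        (precondHessian (misfit (precondOp Γ G)) (sketch (V s) (lam s)))) P ∧
      ∫ s, condNum (precondHessian (misfit (precondOp Γ G)) (sketch (V s) (lam s))) ∂P
        ≤ 1 + Psi (precondOp Γ G) r p) ∧
    (eig (precondOp Γ G) r ≠ 0 →
      Psi (precondOp Γ G) r p =
        (1 + (r : ℝ) / ((p : ℝ) - 1) * intrinsicDim (precondOp Γ G) r) *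
          eig (precondOp Γ G) r) := by
  set A := precondOp Γ G with hA
  obtain ⟨B, hB, hAB⟩ := exists_eig_decomposition A
  have hrn : r ≤ n := hr.trans hmn
  obtain ⟨hE, hEle⟩ := integral_tailError_le hΩ hB A hp hrn le_rfl
  obtain ⟨F, hF, hKF⟩ := exists_measurable_sketch hΩ hout
  have hdet := ae_det_topRows_ne_zero hΩ hB hrn (Nat.le_add_right r p)
  have hF1 : ∀ i j, Measurable fun y => (1 + F y) i j := fun i j => by
    simpa only [Matrix.add_apply] using (hF i j).const_add _
  have hc : ∀ s, 0 ≤ eig A r + tailError A hrn (B * Ω s) := fun s =>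
    add_nonneg (eig_nonneg A r) (tailError_nonneg A hrn _)
  have hΩm := aemeasurable_entries hΩ
  refine ⟨fun g _ => ?_, ?_, fun h => ?_⟩
  · simp only [weightedNorm_step_ratio_eq hΓ, ← hA]
    refine integral_le_of_ae_le_const_add ?_ (fun s => by positivity) ?_ hE hEle
    · refine AEMeasurable.div_const ?_ _
      refine AEMeasurable.congr ((measurable_norm_sub_mulVec (measurable_inv_apply hF1)
        ((1 + misfit A)⁻¹ *ᵥ (msqrt Γ *ᵥ g)) (msqrt Γ *ᵥ g)).comp_aemeasurable hΩm) ?_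
      filter_upwards [hKF] with s hs
      rw [hs]
      rfl
    · filter_upwards [hout, hdet] with s hs hd
      have hK := hs.isSketchOf
      exact div_le_of_le_mul₀ (norm_nonneg _) (hc s) (norm_inv_sub_inv_mulVec_le
        (misfit_transpose A) hK.symm hK.nonneg (hc s) hK.le (hK.quadratic_le hB hAB hrn hd) _)
  -- Regrouped so that `1 + λ_{r+1}` is the deterministic part and only the trailing error is
  -- averaged.
  · rw [Psi, ← add_assoc]
    refine integral_le_of_ae_le_const_add ?_
      (fun s => mul_nonneg (norm_nonneg _) (norm_nonneg _)) ?_ hE hEle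
    · have hM : ∀ C : Matrix (Fin n) (Fin n) ℝ, ∀ {X : (Fin n → Fin (r + p) → ℝ) →
          Matrix (Fin n) (Fin n) ℝ}, (∀ i j, Measurable fun y => X y i j) →
          Measurable fun y => specNorm (C * X y * C) := fun C X hX =>
        measurable_specNorm (measurable_mul_apply (measurable_mul_apply (X := fun _ => C)
          (fun _ _ => measurable_const) hX) (Y := fun _ => C) fun _ _ => measurable_const)
      refine AEMeasurable.congr (((hM (msqrt (1 + misfit A)) (measurable_inv_apply hF1)).mul
        (hM (msqrt (1 + misfit A))⁻¹ hF1)).comp_aemeasurable hΩm) ?_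
      filter_upwards [hKF, hout] with s hs ho
      have hK := ho.isSketchOf
      rw [condNum_precondHessian_eq (misfit_transpose A) hK.symm (misfit_nonneg A) hK.nonneg, hs]
      rfl
    · filter_upwards [hout, hdet] with s hs hd
      have hK := hs.isSketchOf
      rw [add_assoc]
      exact condNum_precondHessian_le (misfit_transpose A) hK.symm hK.nonneg (hc s) hK.le
        (hK.quadratic_le hB hAB hrn hd)
  · rw [Psi, intrinsicDim, add_mul, one_mul, mul_assoc, div_mul_cancel₀ _ h]
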